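/- Let $G=(V,E)$ be a finite simple graph; $G$ is chordal if every cycle of length at least $4$ has a chord. Let $$Z_G(\mathbf x)=\sum_{I\subseteq V\ \text{independent}}(-1)^{|I|}\prod_{v\in I}x_v ,$$ and let $\mathcal R(G)$ be the set of all $\mathbf r\in[0,\infty)^V$ such that $Z_G(\mathbf w)>0$ for all real vectors $\mathbf w$ with $0\le\mathbf w\le\mathbf r$ (entrywise). For $\mathbf h,\mathbf g\in\mathbb N^V$ with all $h_v\ge 1$ (entries of $\mathbf g$ may be $0$), a strategy for the hat guessing game $(G,\mathbf h,\mathbf g)$ is a family $(\Gamma_v)_{v\in V}$, where $\Gamma_v$ maps each tuple of hat colors $(c_u)_{u\in N(v)}$, $c_u\in\{0,\dots,h_u-1\}$, to a set of exactly $g_v$ elements of $\{0,\dots,h_v-1\}$. It is winning if for every $\varphi$ with $\varphi(v)\in\{0,\dots,h_v-1\}$ for all $v\in V$ there is $v\in V$ with $\varphi(v)\in\Gamma_v\bigl((\varphi(u))_{u\in N(v)}\bigr)$. There is a polynomial-time algorithm that, given a chordal graph $G=(V,E)$ with $V=\{0,\dots,n-1\}$ (by its adjacency matrix) and a vector $\mathbf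 r=(r_v)_{v\in V}$ of nonnegative rational numbers (by numerators and denominators in binary), decides whether $\mathbf r\in\mathcal R(G)$. Moreover, if $\mathbf r\notin\mathcal R(G)$, it outputs vectors $\mathbf h,\mathbf g\in\mathbb N^V$ with $h_v\ge1$ and $g_v/h_v\le r_v$ for every $v\in V$, together with a representation $\sigma$ of a winning strategy $(\Gamma_v)_{v\in V}$ for $(G,\mathbf h,\mathbf g)$, and the bit length of this output is polynomial in that of the input. Here "representation" means that there is one fixed polynomial-time algorithm, independent of $G$ and $\mathbf r$, which, given $\sigma$, a vertex $v$, the hat colors $(c_u)_{u\in N(v)}$ and a color $a\in\{0,\dots,h_v-1\}$, decides whether $a\in\Gamma_v\bigl((c_u)_{u\in N(v)}\bigr)$. (Running times are measured on a random access machine with bit-length cost.) -/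

import Mathlib

namespace HatGame

/-! ### Graphs and the region `𝓡(G)` -/

/-- Every cycle of length at least `4` has a chord: an edge of the graph that joins two vertices
of the cycle and is not an edge of the cycle. -/
def IsChordal {V : Type*} (G : SimpleGraph V) : Prop :=
  ∀ (u : V) (c : G.Walk u u), c.IsCycle → 4 ≤ c.length →
    ∃ x ∈ c.support, ∃ y ∈ c.support, G.Adj x y ∧ s(x, y) ∉ c.edges

open Classical in
/-- The signed independence polynomial `Z_G`, evaluated at a real vector `x`. -/
noncomputable def signedIndepPoly {V : Type*} [Fintype V] (G : SimpleGraph V) (x : V → ℝ) : ℝ :=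
  ∑ I ∈ (Finset.univ : Finset (Finset V)).filter (fun I : Finset V => G.IsIndepSet (I : Set V)),
    (-1) ^ I.card * ∏ v ∈ I, x v

/-- The set `𝓡(G)` of the nonnegative vectors `r` such that `Z_G(w) > 0` whenever `0 ≤ w ≤ r`. -/
def region {V : Type*} [Fintype V] (G : SimpleGraph V) : Set (V → ℝ) :=
  {r | 0 ≤ r ∧ ∀ w : V → ℝ, 0 ≤ w → w ≤ r → 0 < signedIndepPoly G w}

/-! ### The hat guessing game `(G, h, g)` -/

/-- What the bear on `v` sees: the hat colors of his neighbors. -/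
abbrev View {V : Type*} (G : SimpleGraph V) (h : V → ℕ) (v : V) : Type _ :=
  (u : G.neighborSet v) → Fin (h u)

/-- A strategy: each bear `v` guesses a set of exactly `g v` of his `h v` colors, depending only
on the hat colors of his neighbors. -/
abbrev Strategy {V : Type*} (G : SimpleGraph V) (h g : V → ℕ) : Type _ :=
  (v : V) → View G h v → {A : Finset (Fin (h v)) // A.card = g v}

/-- In every hats arrangement at least one bear guesses correctly. -/
def Strategy.IsWinning {V : Type*} {G : SimpleGraph V} {h g : V → ℕ}
    (Γ : Strategy G h g) : Prop :=
  ∀ φ : (v : V) → Fin (h v), ∃ v, φ v ∈ (Γ v (fun u => φ u)).1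

/-! ### Random access machines

A program uses finitely many arrays of natural numbers (a scalar variable is a cell of an array),
with indirect addressing. Time is charged by bit length: reading or writing a cell costs the length
of its index and of its contents, and an arithmetic operation costs the product of the lengths of
its operands. -/

/-- The memory: `s A i` is the content of cell `i` of array `A`. -/
abbrev Mem : Type := ℕ → ℕ → ℕ

inductive Op : Type
  | add | sub | mul | div | mod

def Op.eval : Op → ℕ → ℕ → ℕ
  | .add, a, b => a + b
  | .sub, a, b => a - b
  | .mul, a, b => a * b
  | .div, a, b => a / b
  | .mod, a, b => a % b

inductive Expr : Type
  | const (k : ℕ)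
  | read (A : ℕ) (i : Expr)
  | bin (o : Op) (a b : Expr)

def Expr.eval (s : Mem) : Expr → ℕ
  | .const k => k
  | .read A i => s A (i.eval s)
  | .bin o a b => o.eval (a.eval s) (b.eval s)

def Expr.cost (s : Mem) : Expr → ℕ
  | .const k => k.size + 1
  | .read A i => i.cost s + (i.eval s).size + (s A (i.eval s)).size + 1
  | .bin _ a b => a.cost s + b.cost s + ((a.eval s).size + 1) * ((b.eval s).size + 1)

inductive Prog : Type
  | skip
  | write (A : ℕ) (i e : Expr)
  | seq (p q : Prog)
  | branch (e : Expr) (p q : Prog)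
  | loop (e : Expr) (p : Prog)

/-- `Runs p s t s'`: started on memory `s`, the program `p` halts after time `t` with memory `s'`.
A test is passed if its value is nonzero; `loop e p` repeats `p` as long as the test `e` is
passed. -/
inductive Runs : Prog → Mem → ℕ → Mem → Prop
  | skip (s : Mem) : Runs .skip s 1 s
  | write (A : ℕ) (i e : Expr) (s : Mem) :
      Runs (.write A i e) s
        (i.cost s + e.cost s + (i.eval s).size + (e.eval s).size + 1)
        (Function.update s A (Function.update (s A) (i.eval s) (e.eval s)))
  | seq {p q : Prog} {s s' s'' : Mem} {t t' : ℕ} :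
      Runs p s t s' → Runs q s' t' s'' → Runs (.seq p q) s (t + t' + 1) s''
  | branch_pass {e : Expr} {p q : Prog} {s s' : Mem} {t : ℕ} :
      e.eval s ≠ 0 → Runs p s t s' → Runs (.branch e p q) s (e.cost s + t + 1) s'
  | branch_fail {e : Expr} {p q : Prog} {s s' : Mem} {t : ℕ} :
      e.eval s = 0 → Runs q s t s' → Runs (.branch e p q) s (e.cost s + t + 1) s'
  | loop_pass {e : Expr} {p : Prog} {s s' s'' : Mem} {t t' : ℕ} :
      e.eval s ≠ 0 → Runs p s t s' → Runs (.loop e p) s' t' s'' →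
        Runs (.loop e p) s (e.cost s + t + t' + 1) s''
  | loop_fail {e : Expr} {p : Prog} {s : Mem} :
      e.eval s = 0 → Runs (.loop e p) s (e.cost s + 1) s

/-- The initial memory on input `x`: array `0` holds the length of `x` and then its entries;
all other cells are `0`. -/
def initMem (x : List ℕ) : Mem :=
  fun A i => if A = 0 then (x.length :: x).getD i 0 else 0

/-- The output is read from array `1`: its length and then its entries. -/
def output (s : Mem) : List ℕ :=
  (List.range (s 1 0)).map fun i => s 1 (i + 1)

/-- On input `x`, the program `p` halts within time `T` with output `y`. -/
def OutputsWithin (p : Prog) (x : List ℕ) (T : ℕ) (y : List ℕ) : Prop :=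
  ∃ t s, Runs p (initMem x) t s ∧ t ≤ T ∧ output s = y

/-- The number of bits of a list of natural numbers written in binary, with one separator bit per
entry. -/
def bitSize (x : List ℕ) : ℕ :=
  (x.map fun k => k.size + 1).sum

/-! ### Encodings -/

open Classical in
/-- The input `(G, r)`: the number `n` of vertices, the adjacency matrix row by row, the
numerators and the denominators of `r` in lowest terms. -/
noncomputable def encodeInput {n : ℕ} (G : SimpleGraph (Fin n)) (r : Fin n → ℚ≥0) : List ℕ :=
  n :: ((List.finRange n).flatMap fun u => List.ofFn fun v => if G.Adj u v then 1 else 0)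
    ++ List.ofFn (fun v => (r v).num) ++ List.ofFn (fun v => (r v).den)

open Classical in
/-- The question, put to the strategy with description `σ`, whether the bear on `v` who sees the
hat colors `c` includes the color `a` in his guesses. Entry `u` of the list of seen colors is `0`
for every `u` that is not a neighbor of `v`. -/
noncomputable def encodeQuery {n : ℕ} {G : SimpleGraph (Fin n)} {h : Fin n → ℕ} (σ : List ℕ)
    (v : Fin n) (c : View G h v) (a : Fin (h v)) : List ℕ :=
  n :: (v : ℕ) :: (a : ℕ) ::
    List.ofFn (fun u => if hu : G.Adj v u then (c ⟨u, hu⟩ : ℕ) else 0) ++ σ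

open Classical in
/-- The list `σ` represents the strategy `Γ` with respect to the evaluation program `ev`: given
`σ`, a vertex `v`, the hat colors seen by the bear on `v` and a color `a`, the program `ev` decides,
in time `q` of the length of these data, whether the bear guesses `a`. -/
def Represents (ev : Prog) (q : Polynomial ℕ) {n : ℕ} {G : SimpleGraph (Fin n)}
    {h g : Fin n → ℕ} (σ : List ℕ) (Γ : Strategy G h g) : Prop :=
  ∀ (v : Fin n) (c : View G h v) (a : Fin (h v)),
    OutputsWithin ev (encodeQuery σ v c a) (q.eval (bitSize (encodeQuery σ v c a)))
      [if a ∈ (Γ v c).1 then 1 else 0]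

end HatGame

namespace HatGame

/-!
Let `v` be a simplicial vertex. If `x v < 1`, then eliminating `v`, that is, dividing the weights
of its neighbors by `1 - x v`, also divides `Z_G(x)` by `1 - x v`; if `1 ≤ x v`, then `x ∉ 𝓡(G)`. A
chordal graph always has a simplicial vertex, so `r ∈ 𝓡(G)` if and only if the elimination of all
vertices only meets weights less than `1`. All weights are kept as fractions with the same
denominator, which is a common denominator of `r` times the value at `r` of the polynomial of the
eliminated vertices. Hence the numbers stay short.

The elimination is also a strategy. A hat color is a number in mixed radix with one digit for each
round. When `v` is eliminated with weight `g / m`, the vertex `v` and its remaining neighbors form a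
clique and have a digit in `{0, …, m - 1}`. In this round `v` bets that the sum of these digits is
less than `g` modulo `m`, and its neighbors bet that it is not. A vertex guesses the colors with
which it wins all its bets: the ratio `g / m` of `v` uses up its weight, and the ratio `1 - g / m`
of a neighbor makes up for the growth of its weight. If `v` wins its bet, it has no bets left; if
it loses, all other vertices win theirs. So as soon as one bet cannot be lost, because
`1 ≤ g / m`, some vertex guesses correctly.
-/

/-! ### Running times of programs -/

namespace Expr

instance (k : ℕ) : OfNat Expr k := ⟨.const k⟩
instance : Add Expr := ⟨.bin .add⟩
instance : Sub Expr := ⟨.bin .sub⟩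
instance : Mul Expr := ⟨.bin .mul⟩
instance : Div Expr := ⟨.bin .div⟩
instance : Mod Expr := ⟨.bin .mod⟩

/-- The value of `a` if the test `t` is passed, and the value of `b` otherwise. -/
def ite (t a b : Expr) : Expr := (1 - (1 - t)) * a + (1 - t) * b

/-- A test that is passed if the values of `a` and `b` differ. -/
def ne (a b : Expr) : Expr := (a - b) + (b - a)

variable (s : Mem)

@[simp] theorem eval_ofNat (k : ℕ) :
    (no_index (OfNat.ofNat k) : Expr).eval s = OfNat.ofNat k := rfl
@[simp] theorem eval_read (A : ℕ) (i : Expr) : (read A i).eval s = s A (i.eval s) := rfl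
@[simp] theorem eval_add (a b : Expr) : (a + b).eval s = a.eval s + b.eval s := rfl
@[simp] theorem eval_sub (a b : Expr) : (a - b).eval s = a.eval s - b.eval s := rfl
@[simp] theorem eval_mul (a b : Expr) : (a * b).eval s = a.eval s * b.eval s := rfl
@[simp] theorem eval_div (a b : Expr) : (a / b).eval s = a.eval s / b.eval s := rfl
@[simp] theorem eval_mod (a b : Expr) : (a % b).eval s = a.eval s % b.eval s := rfl

@[simp] theorem eval_ite (t a b : Expr) :
    (ite t a b).eval s = if t.eval s = 0 then b.eval s else a.eval s := by
  split_ifs with h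
  · simp [ite, h]
  · simp [ite, Nat.sub_eq_zero_of_le (Nat.one_le_iff_ne_zero.2 h)]

@[simp] theorem eval_ne_eq_zero (a b : Expr) : (ne a b).eval s = 0 ↔ a.eval s = b.eval s := by
  simp only [ne, eval_add, eval_sub]
  omega

/-- A factor that bounds the length of the value of an expression in terms of the word length. -/
def width : Expr → ℕ
  | .const k => k.size
  | .read _ _ => 1
  | .bin _ a b => a.width + b.width + 1

/-- A factor that bounds the cost of an expression in terms of the square of the word length. -/
def weight : Expr → ℕ
  | .const k => k.size + 1
  | .read _ i => i.weight + i.width + 2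
  | .bin _ a b => a.weight + b.weight + (a.width + 1) * (b.width + 1)

end Expr

theorem Op.size_eval_le (o : Op) (a b : ℕ) : (o.eval a b).size ≤ a.size + b.size + 1 := by
  have ha := Nat.lt_size_self a
  have hb := Nat.lt_size_self b
  have two_pow_le {i : ℕ} (hi : i ≤ a.size + b.size) : 2 ^ i ≤ 2 ^ (a.size + b.size) :=
    Nat.pow_le_pow_right two_pos hi
  cases o with
  | add =>
    rw [Nat.size_le, Op.eval, pow_succ, mul_two]
    exact add_lt_add (ha.trans_le (two_pow_le (by omega))) (hb.trans_le (two_pow_le (by omega)))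
  | sub => exact (Nat.size_le_size (Nat.sub_le a b)).trans (by omega)
  | mul =>
    rw [Nat.size_le, Op.eval]
    calc a * b < 2 ^ a.size * 2 ^ b.size := Nat.mul_lt_mul'' ha hb
      _ = 2 ^ (a.size + b.size) := (pow_add ..).symm
      _ ≤ 2 ^ (a.size + b.size + 1) := Nat.pow_le_pow_right two_pos (Nat.le_succ _)
  | div => exact (Nat.size_le_size (Nat.div_le_self a b)).trans (by omega)
  | mod => exact (Nat.size_le_size (Nat.mod_le a b)).trans (by omega)

namespace Mem

/-- All cells hold numbers of at most `B` bits. -/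
def Bounded (B : ℕ) (s : Mem) : Prop := ∀ A i, s A i < 2 ^ B

/-- The memory after the value `v` has been written to cell `i` of array `A`. -/
def set (s : Mem) (A i v : ℕ) : Mem := Function.update s A (Function.update (s A) i v)

@[simp] theorem set_self (s : Mem) (A i v : ℕ) : s.set A i v A = Function.update (s A) i v :=
  Function.update_self ..

@[simp] theorem set_of_ne (s : Mem) {A A' : ℕ} (i v : ℕ) (h : A' ≠ A) : s.set A i v A' = s A' :=
  Function.update_of_ne h ..

theorem Bounded.set {B : ℕ} {s : Mem} (hs : s.Bounded B) (A i : ℕ) {v : ℕ} (hv : v < 2 ^ B) :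
    (s.set A i v).Bounded B := by
  intro A' i'
  by_cases hA : A' = A
  · subst hA
    rw [set_self, Function.update_apply]
    split_ifs
    exacts [hv, hs A' i']
  · simpa only [set_of_ne s i v hA] using hs A' i'

end Mem

namespace Expr

variable {B : ℕ} {s : Mem}

theorem size_eval_le (hs : s.Bounded B) (e : Expr) : (e.eval s).size ≤ e.width * (B + 1) := by
  induction e with
  | const k => simp only [eval, width]; nlinarith
  | read A i _ =>
    simp only [eval, width]
    have := Nat.size_le.2 (hs A (i.eval s))
    omega
  | bin o a b iha ihb =>
    simp only [eval, width]
    have := o.size_eval_le (a.eval s) (b.eval s)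
    nlinarith

theorem size_eval_le_sq (hs : s.Bounded B) (e : Expr) :
    (e.eval s).size ≤ e.width * (B + 1) ^ 2 :=
  (size_eval_le hs e).trans (Nat.mul_le_mul_left _ (Nat.le_self_pow two_ne_zero _))

theorem cost_le (hs : s.Bounded B) (e : Expr) : e.cost s ≤ e.weight * (B + 1) ^ 2 := by
  have hB : B + 1 ≤ (B + 1) ^ 2 := Nat.le_self_pow two_ne_zero _
  induction e with
  | const k => simp only [cost, weight]; nlinarith
  | read A i ih =>
    simp only [cost, weight]
    have hcell := Nat.size_le.2 (hs A (i.eval s))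
    have hindex := size_eval_le_sq hs i
    nlinarith
  | bin o a b iha ihb =>
    simp only [cost, weight]
    have ha : (a.eval s).size + 1 ≤ (a.width + 1) * (B + 1) := by
      have := size_eval_le hs a; nlinarith
    have hb : (b.eval s).size + 1 ≤ (b.width + 1) * (B + 1) := by
      have := size_eval_le hs b; nlinarith
    have := Nat.mul_le_mul ha hb
    nlinarith

end Expr

namespace Prog

instance : AndThen Prog := ⟨fun p q => .seq p (q ())⟩

/-- The arrays that a program may change. -/
def writes : Prog → List ℕ
  | skip => []
  | write A _ _ => [A]
  | seq p q => p.writes ++ q.writes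
  | branch _ p q => p.writes ++ q.writes
  | loop _ p => p.writes

open Polynomial in
/-- A bound for the running time, divided by the square of the word length, in terms of the number
of rounds of each loop. -/
noncomputable def timeBound : Prog → ℕ[X]
  | skip => 1
  | write _ i e => C (i.weight + e.weight + i.width + e.width + 1)
  | seq p q => p.timeBound + q.timeBound + 1
  | branch e p q => C e.weight + p.timeBound + q.timeBound + 1
  | loop e p => (X + 1) * (C e.weight + p.timeBound + 1)

theorem writes_andThen (p q : Prog) : (p >> q).writes = p.writes ++ q.writes := rfl

/-- Runs `p` once for each `k` below the value of `e`; meanwhile cell `0` of array `c` holds `k`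
and cell `1` holds the number of rounds. -/
def times (c : ℕ) (e : Expr) (p : Prog) : Prog :=
  .write c 1 e >> .write c 0 0 >>
    .loop (.read c 1 - .read c 0) (p >> .write c 0 (.read c 0 + 1))

end Prog

open Prog

theorem Runs.frame {p : Prog} {s s' : Mem} {t : ℕ} (h : Runs p s t s') {A : ℕ}
    (hA : A ∉ p.writes) : s' A = s A := by
  induction h with
  | skip => rfl
  | write A' i e s => exact Function.update_of_ne (List.ne_of_not_mem_cons hA) ..
  | seq _ _ ihp ihq =>
    simp only [writes, List.mem_append, not_or] at hA
    rw [ihq hA.2, ihp hA.1]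
  | branch_pass _ _ ih => exact ih fun h => hA (List.mem_append_left _ h)
  | branch_fail _ _ ih => exact ih fun h => hA (List.mem_append_right _ h)
  | loop_pass _ _ _ ihp ihl => rw [ihl hA, ihp hA]
  | loop_fail => rfl

/-! ### Weakest preconditions -/

/-- Started on `s`, the program `p` halts with a memory that has property `Q`, provided that all
numbers in `s` have at most `B` bits; this is so for the new memory, too, and the time is that of a
program each of whose loops makes at most `N` rounds. -/
def Wp (B N : ℕ) (p : Prog) (Q : Mem → Prop) (s : Mem) : Prop :=
  N < 2 ^ B → s.Bounded B →
    ∃ t s', Runs p s t s' ∧ t ≤ p.timeBound.eval N * (B + 1) ^ 2 ∧ s'.Bounded B ∧ Q s'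

section Wp

variable {B N : ℕ} {Q : Mem → Prop} {s : Mem} {p q : Prog}

theorem Wp.mono {Q' : Mem → Prop} (h : Wp B N p Q' s)
    (hQ : ∀ s', (∀ A ∉ p.writes, s' A = s A) → Q' s' → Q s') : Wp B N p Q s := by
  intro hN hs
  obtain ⟨t, s', hrun, ht, hs', hQ'⟩ := h hN hs
  exact ⟨t, s', hrun, ht, hs', hQ s' (fun _ => hrun.frame) hQ'⟩

theorem one_le_sq (B : ℕ) : 1 ≤ (B + 1) ^ 2 := Nat.one_le_pow _ _ B.succ_pos

theorem wp_skip (h : Q s) : Wp B N .skip Q s := fun _ hs =>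
  ⟨1, s, .skip s, by simpa [timeBound] using one_le_sq B, hs, h⟩

theorem wp_write {A : ℕ} {i e : Expr} (he : e.eval s < 2 ^ B)
    (h : Q (s.set A (i.eval s) (e.eval s))) : Wp B N (.write A i e) Q s := by
  refine fun _ hs => ⟨_, _, .write A i e s, ?_, hs.set _ _ he, h⟩
  simp only [timeBound, Polynomial.eval_C]
  have := Expr.cost_le hs i
  have := Expr.cost_le hs e
  have := Expr.size_eval_le_sq hs i
  have := Expr.size_eval_le_sq hs e
  nlinarith [one_le_sq B]

theorem wp_seq (h : Wp B N p (Wp B N q Q) s) : Wp B N (p >> q) Q s := by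
  intro hN hs
  obtain ⟨t, s', hp, ht, hs', h'⟩ := h hN hs
  obtain ⟨t', s'', hq, ht', hs'', hQ⟩ := h' hN hs'
  refine ⟨_, s'', hp.seq hq, ?_, hs'', hQ⟩
  change _ ≤ ((Prog.seq p q).timeBound).eval N * _
  simp only [timeBound, Polynomial.eval_add, Polynomial.eval_one]
  nlinarith [one_le_sq B]

theorem wp_branch {e : Expr} (hp : e.eval s ≠ 0 → Wp B N p Q s)
    (hq : e.eval s = 0 → Wp B N q Q s) : Wp B N (.branch e p q) Q s := by
  intro hN hs
  have hcost := Expr.cost_le hs e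
  by_cases he : e.eval s = 0
  · obtain ⟨t, s', hrun, ht, hs', hQ⟩ := hq he hN hs
    refine ⟨_, s', .branch_fail he hrun, ?_, hs', hQ⟩
    simp only [timeBound, Polynomial.eval_add, Polynomial.eval_one, Polynomial.eval_C]
    nlinarith [one_le_sq B]
  · obtain ⟨t, s', hrun, ht, hs', hQ⟩ := hp he hN hs
    refine ⟨_, s', .branch_pass he hrun, ?_, hs', hQ⟩
    simp only [timeBound, Polynomial.eval_add, Polynomial.eval_one, Polynomial.eval_C]
    nlinarith [one_le_sq B]

/-- In the invariant `I j`, the number `j` counts the rounds that are still to be made. -/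
theorem wp_loop {e : Expr} (I : ℕ → Mem → Prop)
    (hpass : ∀ j s', I (j + 1) s' → e.eval s' ≠ 0 ∧ Wp B N p (I j) s')
    (hfail : ∀ s', I 0 s' → e.eval s' = 0) {n : ℕ} (hn : n ≤ N) (h : I n s) :
    Wp B N (.loop e p) (I 0) s := by
  intro hN hs
  have key : ∃ t s', Runs (.loop e p) s t s' ∧
      t ≤ (n + 1) * (e.weight + p.timeBound.eval N + 1) * (B + 1) ^ 2 ∧ s'.Bounded B ∧ I 0 s' := by
    clear hn
    induction n generalizing s with
    | zero =>
      refine ⟨_, s, .loop_fail (hfail s h), ?_, hs, h⟩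
      nlinarith [Expr.cost_le hs e, one_le_sq B]
    | succ j ih =>
      have hcost := Expr.cost_le hs e
      obtain ⟨he, hp⟩ := hpass j s h
      obtain ⟨t, s', hrun, ht, hs', h'⟩ := hp hN hs
      obtain ⟨t', s'', hrun', ht', hs'', h''⟩ := ih h' hs'
      refine ⟨_, s'', .loop_pass he hrun hrun', ?_, hs'', h''⟩
      nlinarith [one_le_sq B]
  obtain ⟨t, s', hrun, ht, hs', h'⟩ := key
  refine ⟨t, s', hrun, ht.trans (Nat.mul_le_mul_right _ ?_), hs', h'⟩
  simp only [timeBound, Polynomial.eval_mul, Polynomial.eval_add, Polynomial.eval_one,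
    Polynomial.eval_C, Polynomial.eval_X]
  gcongr

theorem wp_times {c : ℕ} {e : Expr} {n : ℕ} (hc : c ∉ p.writes) (hn : e.eval s = n) (hnN : n ≤ N)
    (I : ℕ → Mem → Prop) (hI : ∀ k s s', (∀ A ≠ c, s' A = s A) → I k s → I k s') (h0 : I 0 s)
    (hstep : ∀ k < n, ∀ s', (∀ A ∉ c :: p.writes, s' A = s A) → s' c 0 = k → I k s' →
      Wp B N p (I (k + 1)) s')
    (hQ : ∀ s', (∀ A ∉ c :: p.writes, s' A = s A) → I n s' → Q s') :
    Wp B N (times c e p) Q s := by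
  intro hNB
  have set_eq (s' : Mem) (i v : ℕ) : ∀ A ≠ c, s'.set c i v A = s' A := fun A => Mem.set_of_ne _ _ _
  let J (j : ℕ) (s' : Mem) : Prop := (∀ A ∉ c :: p.writes, s' A = s A) ∧
    ∃ k, k + j = n ∧ s' c 0 = k ∧ s' c 1 = n ∧ I k s'
  have hloop (s₀ : Mem) (h : J n s₀) : Wp B N
      (.loop (.read c 1 - .read c 0) (p >> .write c 0 (.read c 0 + 1))) Q s₀ := by
    refine (wp_loop J ?_ ?_ hnN h).mono fun s' _ ⟨hframe, k, hk, _, _, h⟩ => ?_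
    · rintro j s' ⟨hframe, k, hk, h0, h1, h⟩
      refine ⟨by simp only [Expr.eval_sub, Expr.eval_read, Expr.eval_ofNat, h0, h1]; omega, ?_⟩
      refine wp_seq ((hstep k (by omega) s' hframe h0 h).mono fun s'' hframe' h' => ?_)
      have hcell : s'' c = s' c := hframe' c hc
      refine wp_write (by simp [hcell, h0]; omega) ⟨fun A hA => ?_, k + 1, by omega, ?_, ?_, ?_⟩
      · rw [List.mem_cons, not_or] at hA
        rw [set_eq _ _ _ A hA.1, hframe' A hA.2, hframe A (List.not_mem_cons_of_ne_of_not_mem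
          hA.1 hA.2)]
      · simp [hcell, h0]
      · simp [hcell, h1]
      · exact hI _ _ _ (set_eq _ _ _) h'
    · rintro s' ⟨-, k, hk, h0, h1, -⟩
      simp only [Expr.eval_sub, Expr.eval_read, Expr.eval_ofNat, h0, h1]
      omega
    · exact hQ s' hframe (by rwa [show k = n from hk] at h)
  refine wp_seq (wp_write (by omega) (wp_seq (wp_write (by simp) (hloop _ ⟨fun A hA => ?_, 0,
    Nat.zero_add n, by simp, by simp [hn], ?_⟩)))) hNB
  · rw [set_eq _ _ _ A (List.ne_of_not_mem_cons hA), set_eq _ _ _ A (List.ne_of_not_mem_cons hA)]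
  · exact hI _ _ _ (set_eq _ _ _) (hI _ _ _ (set_eq _ _ _) h0)

/-! ### Loops with a single assignment -/

section Loops

variable {A c n : ℕ} {bound i e : Expr}

theorem wp_fold (hAc : A ≠ c) (hn : bound.eval s = n) (hnN : n ≤ N) (F : ℕ → ℕ)
    (h0 : s A 0 = F 0) (hF : ∀ k ≤ n, F k < 2 ^ B)
    (he : ∀ k < n, ∀ s', (∀ A' ∉ [c, A], s' A' = s A') → s' c 0 = k → s' A 0 = F k →
      e.eval s' = F (k + 1))
    (hQ : ∀ s', (∀ A' ∉ [c, A], s' A' = s A') → s' A 0 = F n → Q s') :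
    Wp B N (times c bound (.write A 0 e)) Q s := by
  refine wp_times (by simpa [writes] using hAc.symm) hn hnN (fun k s' => s' A 0 = F k)
    (fun k s s' h h' => by rw [h A hAc]; exact h') h0 (fun k hk s' hframe hk' h => ?_) hQ
  have he' := he k hk s' hframe hk' h
  exact wp_write (he' ▸ hF (k + 1) hk) (by simp [he'])

theorem wp_fill (hAc : A ≠ c) (hn : bound.eval s = n) (hnN : n ≤ N) (f : Fin n → ℕ)
    (hf : ∀ k, f k < 2 ^ B)
    (hi : ∀ (k : Fin n) s', (∀ A' ∉ [c, A], s' A' = s A') → s' c 0 = (k : ℕ) → s' A k = s A k →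
      e.eval s' = f k)
    (hQ : ∀ s', (∀ A' ∉ [c, A], s' A' = s A') → (∀ k : Fin n, s' A k = f k) → Q s') :
    Wp B N (times c bound (.write A (.read c 0) e)) Q s := by
  refine wp_times (by simpa [writes] using hAc.symm) hn hnN
    (fun k s' => ∀ u : Fin n, s' A u = if (u : ℕ) < k then f u else s A u)
    (fun k s s' h h' => by rw [h A hAc]; exact h') (by simp) (fun k hk s' hframe hk' h => ?_)
    fun s' hframe h => hQ s' hframe fun u => by rw [h u, if_pos u.2]
  have he := hi ⟨k, hk⟩ s' hframe hk' (by simpa using h ⟨k, hk⟩)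
  refine wp_write (he ▸ hf _) fun u => ?_
  rw [he, Expr.eval_read, Expr.eval_ofNat, hk', Mem.set_self, Function.update_apply]
  rcases eq_or_ne (u : ℕ) k with rfl | hu
  · simp
  · rw [if_neg hu, h u]
    exact if_congr (by omega) rfl rfl

end Loops

/-! ### Lists in the memory -/

/-- The list stored in array `A`: its length and then its entries. -/
def listAt (s : Mem) (A : ℕ) : List ℕ := (List.range (s A 0)).map fun i => s A (i + 1)

/-- Appends the value of `e` to the list in array `A`. -/
def push (A : ℕ) (e : Expr) : Prog :=
  .write A (.read A 0 + 1) e >> .write A 0 (.read A 0 + 1)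

theorem length_listAt (s : Mem) (A : ℕ) : (listAt s A).length = s A 0 := by simp [listAt]

theorem listAt_congr {s s' : Mem} {A A' : ℕ} (h : s' A = s A') : listAt s' A = listAt s A' := by
  simp only [listAt, h]

theorem wp_push {A : ℕ} {e : Expr} (he : e.eval s < 2 ^ B)
    (hlength : (listAt s A).length + 1 < 2 ^ B)
    (hQ : ∀ s', (∀ A' ≠ A, s' A' = s A') → listAt s' A = listAt s A ++ [e.eval s] → Q s') :
    Wp B N (push A e) Q s := by
  rw [length_listAt] at hlength
  refine wp_seq (wp_write he (wp_write (by simpa using hlength) (hQ _ (fun A' hA => ?_) ?_)))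
  · rw [Mem.set_of_ne _ _ _ hA, Mem.set_of_ne _ _ _ hA]
  · simp only [listAt, Mem.set_self, Expr.eval_add, Expr.eval_read, Expr.eval_ofNat,
      Function.update_self, ne_eq, Nat.zero_ne_add_one, not_false_eq_true, Function.update_of_ne,
      Nat.add_eq_zero_iff, one_ne_zero, and_false, List.range_succ, List.map_append,
      List.map_cons, List.map_nil]
    congr 1
    refine List.map_congr_left fun j hj => Function.update_of_ne ?_ ..
    have := List.mem_range.1 hj
    omega

theorem wp_pushAll {A c n : ℕ} {bound e : Expr} (hAc : A ≠ c) (hn : bound.eval s = n) (hnN : n ≤ N)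
    (f : Fin n → ℕ) (hf : ∀ k, f k < 2 ^ B) (hlength : (listAt s A).length + n < 2 ^ B)
    (he : ∀ (k : Fin n) s', (∀ A' ∉ [c, A], s' A' = s A') → s' c 0 = (k : ℕ) →
      e.eval s' = f k)
    (hQ : ∀ s', (∀ A' ∉ [c, A], s' A' = s A') → listAt s' A = listAt s A ++ List.ofFn f → Q s') :
    Wp B N (times c bound (push A e)) Q s := by
  have frame {s' : Mem} (h : ∀ A' ∉ c :: (push A e).writes, s' A' = s A') :
      ∀ A' ∉ [c, A], s' A' = s A' := fun A' hA => h A' (by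
    simpa [push, writes, HAndThen.hAndThen, AndThen.andThen] using hA)
  refine wp_times (by simpa [push, writes, HAndThen.hAndThen, AndThen.andThen] using hAc.symm)
    hn hnN (fun k s' => listAt s' A = listAt s A ++ (List.ofFn f).take k)
    (fun k s s' h h' => (listAt_congr (h A hAc)).trans h') (by simp)
    (fun k hk s' hframe hk' h => ?_)
    fun s' hframe h => hQ s' (frame hframe) (by rwa [List.take_of_length_le (by simp)] at h)
  have he' := he ⟨k, hk⟩ s' (frame hframe) hk'
  refine wp_push (he' ▸ hf _) ?_ fun s'' _ h' => ?_
  · simp only [h, List.length_append, List.length_take, List.length_ofFn]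
    omega
  · rw [h', h, he', List.append_assoc, List.take_succ_eq_append_getElem (by simpa using hk),
      List.getElem_ofFn]

end Wp

/-! ### Simplicial vertices of chordal graphs -/

section Chordal

variable {V : Type*} {G : SimpleGraph V}

open SimpleGraph

theorem mem_edges_of_length_eq_dist {x y : V} {p : G.Walk x y} (hp : p.length = G.dist x y)
    {a b : V} (ha : a ∈ p.support) (hb : b ∈ p.support) (hab : G.Adj a b) : s(a, b) ∈ p.edges := by
  obtain ⟨i, rfl, hi⟩ := Walk.mem_support_iff_exists_getVert.1 ha
  obtain ⟨j, rfl, hj⟩ := Walk.mem_support_iff_exists_getVert.1 hb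
  wlog hij : i < j generalizing i j
  · rcases (not_lt.1 hij).lt_or_eq with hji | rfl
    · rw [Sym2.eq_swap]
      exact this j hj hb i hi ha hab.symm hji
    · exact absurd hab (G.loopless.irrefl _)
  -- The edge is a shortcut of the walk unless `j = i + 1`.
  have hshort := dist_le ((p.take i).append (.cons hab (p.drop j)))
  simp only [Walk.length_append, Walk.length_cons, Walk.take_length, Walk.drop_length] at hshort
  obtain rfl : j = i + 1 := by omega
  exact Walk.adj_toSubgraph_iff_mem_edges.1 (p.toSubgraph_adj_getVert hj)

theorem isCycle_cons_concat {v x y : V} {p : G.Walk x y} (hp : p.IsPath) (hv : v ∉ p.support)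
    (hxy : x ≠ y) (hx : G.Adj v x) (hy : G.Adj v y) :
    (Walk.cons hx (p.concat hy.symm)).IsCycle := by
  refine (Walk.cons_isCycle_iff _ hx).2 ⟨hp.concat hv _, ?_⟩
  simp only [Walk.edges_concat, List.concat_eq_append, List.mem_append, List.mem_singleton,
    Sym2.eq_iff, not_or, not_and]
  exact ⟨fun h => hv (p.fst_mem_support_of_mem_edges h), fun h => absurd h hy.ne,
    fun _ h => hxy h⟩

theorem IsChordal.exists_chord (hG : IsChordal G) {v x y : V} {p : G.Walk x y} (hp : p.IsPath)
    (hv : v ∉ p.support) (hxy : x ≠ y) (hx : G.Adj v x) (hy : G.Adj v y) (hn : ¬ G.Adj x y)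
    (hend : ∀ a ∈ p.support, G.Adj v a → a = x ∨ a = y) :
    ∃ a ∈ p.support, ∃ b ∈ p.support, G.Adj a b ∧ s(a, b) ∉ p.edges := by
  have hlength : 2 ≤ p.length := by
    by_contra! h
    obtain h0 | h1 : p.length = 0 ∨ p.length = 1 := by omega
    exacts [hxy (Walk.eq_of_length_eq_zero h0), hn (Walk.adj_of_length_eq_one h1)]
  obtain ⟨a, ha, b, hb, hab, he⟩ := hG v _ (isCycle_cons_concat hp hv hxy hx hy)
    (by simp only [Walk.length_cons, Walk.length_concat]; omega)
  simp only [Walk.support_cons, Walk.support_concat, List.mem_cons, List.mem_append,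
    List.not_mem_nil, or_false] at ha hb
  simp only [Walk.edges_cons, Walk.edges_concat, List.concat_eq_append, List.mem_cons,
    List.mem_append, List.not_mem_nil, or_false, not_or] at he
  have away {c d : V} (hd : d = v ∨ d ∈ p.support ∨ d = v) (hcd : G.Adj c d)
      (h1 : s(c, d) ≠ s(v, x)) (h2 : s(c, d) ≠ s(y, v)) : c ≠ v := by
    rintro rfl
    have hd' : d ∈ p.support := by
      rcases hd with h | h | h
      exacts [absurd h hcd.ne', h, absurd h hcd.ne']
    rcases hend d hd' hcd with rfl | rfl
    exacts [h1 rfl, h2 Sym2.eq_swap]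
  have hav := away hb hab he.1 he.2.2
  have hbv := away ha hab.symm (fun h => he.1 (Sym2.eq_swap.trans h))
    fun h => he.2.2 (Sym2.eq_swap.trans h)
  exact ⟨a, by tauto, b, by tauto, hab, he.2.1⟩

theorem IsChordal.adj_of_reachable (hG : IsChordal G) {v : V} {U : Set V} {x y : U} (hxy : x ≠ y)
    (hx : G.Adj v x) (hy : G.Adj v y) (hv : v ∉ U)
    (hU : ∀ a : U, G.Adj v a → a = x ∨ a = y) (hr : (G.induce U).Reachable x y) :
    G.Adj x y := by
  by_contra hn
  obtain ⟨p, hp, hlength⟩ := hr.exists_path_of_dist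
  set f := (Embedding.induce (G := G) U).toHom
  have hsupport {a : V} (ha : a ∈ (p.map f).support) : ∃ a' ∈ p.support, (a' : V) = a := by
    rw [Walk.support_map] at ha
    exact List.mem_map.1 ha
  obtain ⟨a, ha, b, hb, hab, he⟩ := hG.exists_chord (p := p.map f)
    (hp.map Subtype.val_injective)
    (fun h => by obtain ⟨a, -, rfl⟩ := hsupport h; exact hv a.2)
    (Subtype.val_injective.ne hxy) hx hy hn (fun a ha hva => by
      obtain ⟨a, -, rfl⟩ := hsupport ha
      exact (hU a hva).imp (congrArg _) (congrArg _))
  obtain ⟨a, ha', rfl⟩ := hsupport ha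
  obtain ⟨b, hb', rfl⟩ := hsupport hb
  rw [Walk.edges_map] at he
  exact he (List.mem_map_of_mem (f := Sym2.map f) (mem_edges_of_length_eq_dist hlength ha' hb' hab))

theorem IsChordal.isClique_attachments (hG : IsChordal G) {v : V} {C : Set V}
    (hC : (G.induce C).Connected) (hv : v ∉ C) (hvC : ∀ c ∈ C, ¬ G.Adj v c) :
    G.IsClique {x | G.Adj v x ∧ ∃ c ∈ C, G.Adj x c} := by
  rintro x ⟨hvx, c, hc, hxc⟩ y ⟨hvy, d, hd, hyd⟩ hxy
  have hconn : (G.induce ({y} ∪ ({x} ∪ C))).Connected :=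
    connected_induce_union .of_subsingleton
      (connected_induce_union .of_subsingleton hC.preconnected (Set.mem_singleton x) hc
        hxc).preconnected (Set.mem_singleton y) (.inr hd) hyd
  refine hG.adj_of_reachable (x := ⟨x, .inr (.inl rfl)⟩) (y := ⟨y, .inl rfl⟩)
    (fun h => hxy (congrArg Subtype.val h)) hvx hvy ?_ ?_ (hconn.preconnected _ _)
  · rintro (h | h | h)
    exacts [hvy.ne h, hvx.ne h, hv h]
  · rintro ⟨a, h | h | h⟩ hva
    exacts [.inr (Subtype.ext h), .inl (Subtype.ext h), absurd hva (hvC a h)]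

theorem exists_connected_closed {U : Set V} {z : V} (hz : z ∈ U) :
    ∃ C ⊆ U, z ∈ C ∧ (G.induce C).Connected ∧ ∀ c ∈ C, ∀ x ∈ U, G.Adj c x → x ∈ C := by
  classical
  let C : Set V := {c | ∃ p : G.Walk z c, ∀ a ∈ p.support, a ∈ U}
  have hzC : z ∈ C := ⟨.nil, by simpa using hz⟩
  refine ⟨C, fun c ⟨p, hp⟩ => hp c p.end_mem_support, hzC,
    induce_connected_of_patches z hzC fun {c} ⟨p, hp⟩ => ?_, fun c ⟨p, hp⟩ x hx hcx => ?_⟩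
  · refine ⟨{a | a ∈ p.support}, fun a ha => ⟨p.takeUntil a ha, fun b hb => ?_⟩,
      p.start_mem_support, p.end_mem_support, p.connected_induce_support.preconnected _ _⟩
    exact hp b (p.support_takeUntil_subset_support ha hb)
  · refine ⟨p.concat hcx, fun a ha => ?_⟩
    simp only [Walk.support_concat, List.mem_append, List.mem_singleton] at ha
    rcases ha with ha | rfl
    exacts [hp a ha, hx]

/-- The neighbors of `v` in `W` are pairwise adjacent. -/
def IsSimplicialIn (G : SimpleGraph V) (W : Finset V) (v : V) : Prop :=
  G.IsClique {x | x ∈ W ∧ G.Adj v x}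

theorem IsSimplicialIn.mono {W W' : Finset V} {v : V} (hv : IsSimplicialIn G W v) (h : W' ⊆ W) :
    IsSimplicialIn G W' v :=
  fun _ hu _ hw => hv ⟨h hu.1, hu.2⟩ ⟨h hw.1, hw.2⟩

theorem exists_simplicial_mem_of_isClique [DecidableEq V] {C S : Finset V} (hC : C.Nonempty)
    (hS : G.IsClique S)
    (hdirac : ∀ v ∈ C ∪ S, ∀ z ∈ C ∪ S, z ≠ v → ¬ G.Adj v z →
      ∃ s ∈ C ∪ S, s ≠ v ∧ ¬ G.Adj v s ∧ IsSimplicialIn G (C ∪ S) s) :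
    ∃ c ∈ C, IsSimplicialIn G (C ∪ S) c := by
  by_cases hfull : ∃ v ∈ C ∪ S, ∃ z ∈ C ∪ S, z ≠ v ∧ ¬ G.Adj v z
  · obtain ⟨v, hv, z, hz, hzv, hvz⟩ := hfull
    obtain ⟨s, hs, hsv, hvs, hsimp⟩ := hdirac v hv z hz hzv hvz
    by_cases hsC : s ∈ C
    · exact ⟨s, hsC, hsimp⟩
    -- A second simplicial vertex, not adjacent to `s ∈ S`, lies in `C`.
    have hsS := (Finset.mem_union.1 hs).resolve_left hsC
    obtain ⟨t, ht, hts, hst, htsimp⟩ := hdirac s hs v hv hsv.symm fun h => hvs h.symm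
    exact ⟨t, (Finset.mem_union.1 ht).resolve_right fun htS => hst (hS hsS htS hts.symm), htsimp⟩
  · push Not at hfull
    obtain ⟨c, hc⟩ := hC
    exact ⟨c, hc, fun x hx y hy hxy => hfull x hx.1 y hy.1 hxy.symm⟩

theorem IsChordal.exists_simplicial_not_adj (hG : IsChordal G) (W : Finset V) {v z : V}
    (hv : v ∈ W) (hz : z ∈ W) (hzv : z ≠ v) (hvz : ¬ G.Adj v z) :
    ∃ s ∈ W, s ≠ v ∧ ¬ G.Adj v s ∧ IsSimplicialIn G W s := by
  classical
  induction W using Finset.strongInduction generalizing v z with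
  | H W ih =>
  obtain ⟨C, hCU, hzC, hconn, hclosed⟩ := exists_connected_closed (G := G)
    (show z ∈ {c | c ∈ W ∧ c ≠ v ∧ ¬ G.Adj v c} from ⟨hz, hzv, hvz⟩)
  have hvC : v ∉ C := fun h => (hCU h).2.1 rfl
  let C' : Finset V := {c ∈ W | c ∈ C}
  let S : Finset V := {x ∈ W | G.Adj v x ∧ ∃ c ∈ C, G.Adj x c}
  have hS : G.IsClique S :=
    (hG.isClique_attachments hconn hvC fun c hc => (hCU hc).2.2).subset fun x hx =>
      (Finset.mem_filter.1 hx).2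
  have hssub : C' ∪ S ⊂ W := (Finset.ssubset_iff_of_subset (Finset.union_subset
    (Finset.filter_subset _ _) (Finset.filter_subset _ _))).2 ⟨v, hv, by simp [hvC]⟩
  obtain ⟨c, hc, hsimp⟩ := exists_simplicial_mem_of_isClique (C := C')
    ⟨z, Finset.mem_filter.2 ⟨hz, hzC⟩⟩ hS
    fun v hv z hz hzv hvz => ih _ hssub hv hz hzv hvz
  obtain ⟨hcW, hcC⟩ := Finset.mem_filter.1 hc
  refine ⟨c, hcW, (hCU hcC).2.1, (hCU hcC).2.2, hsimp.subset ?_⟩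
  refine fun x ⟨hxW, hcx⟩ => ⟨?_, hcx⟩
  have hxv : x ≠ v := fun h => (hCU hcC).2.2 (h ▸ hcx.symm)
  by_cases hvx : G.Adj v x
  · exact Finset.mem_union_right _ (Finset.mem_filter.2 ⟨hxW, hvx, c, hcC, hcx.symm⟩)
  · exact Finset.mem_union_left _
      (Finset.mem_filter.2 ⟨hxW, hclosed c hcC x ⟨hxW, hxv, hvx⟩ hcx⟩)

theorem IsChordal.exists_simplicial (hG : IsChordal G) {W : Finset V} (hW : W.Nonempty) :
    ∃ v ∈ W, IsSimplicialIn G W v := by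
  classical
  have h := exists_simplicial_mem_of_isClique (G := G) (S := ∅) hW (by simp)
  rw [Finset.union_empty] at h
  exact h fun v hv z hz hzv hvz => hG.exists_simplicial_not_adj W hv hz hzv hvz

end Chordal

/-! ### Elimination of a simplicial vertex from the signed independence polynomial -/

section IndepSum

variable {V : Type*} {G : SimpleGraph V} {W : Finset V} {v : V} {x : V → ℝ}

/-- The term of the set `I` in the signed independence polynomial. -/
def indepTerm (x : V → ℝ) (I : Finset V) : ℝ := (-1) ^ I.card * ∏ v ∈ I, x v

open Classical in
/-- The independent sets contained in `W`. -/
noncomputable def indepSets (G : SimpleGraph V) (W : Finset V) : Finset (Finset V) :=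
  W.powerset.filter fun I : Finset V => G.IsIndepSet (I : Set V)

/-- The signed independence polynomial of the subgraph induced by `W`. -/
noncomputable def indepSum (G : SimpleGraph V) (W : Finset V) (x : V → ℝ) : ℝ :=
  ∑ I ∈ indepSets G W, indepTerm x I

open Classical in
/-- The weights after the elimination of `v`. -/
noncomputable def eliminate (G : SimpleGraph V) (v : V) (x : V → ℝ) : V → ℝ :=
  fun u => if G.Adj v u then x u / (1 - x v) else x u

/-- The signed independence polynomial of the subgraph induced by `W` is positive on the box below
`x`. -/
def PositiveBelow (G : SimpleGraph V) (W : Finset V) (x : V → ℝ) : Prop :=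
  ∀ w : V → ℝ, 0 ≤ w → w ≤ x → 0 < indepSum G W w

theorem mem_indepSets {I : Finset V} :
    I ∈ indepSets G W ↔ I ⊆ W ∧ G.IsIndepSet (I : Set V) := by
  simp [indepSets]

theorem indepSum_univ [Fintype V] (x : V → ℝ) :
    indepSum G Finset.univ x = signedIndepPoly G x := by
  rw [indepSum, indepSets, Finset.powerset_univ]
  rfl

@[simp] theorem indepSum_empty (x : V → ℝ) : indepSum G ∅ x = 1 := by
  simp [indepSum, indepSets, indepTerm, Finset.sum_filter]

theorem indepTerm_congr {y : V → ℝ} {I : Finset V} (h : ∀ u ∈ I, x u = y u) :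
    indepTerm x I = indepTerm y I := by
  rw [indepTerm, indepTerm, Finset.prod_congr rfl h]

theorem indepSum_congr {y : V → ℝ} (h : ∀ u ∈ W, x u = y u) : indepSum G W x = indepSum G W y :=
  Finset.sum_congr rfl fun _ hI => indepTerm_congr fun u hu => h u ((mem_indepSets.1 hI).1 hu)

theorem indepTerm_insert [DecidableEq V] {I : Finset V} (hv : v ∉ I) :
    indepTerm x (insert v I) = -x v * indepTerm x I := by
  simp only [indepTerm, Finset.card_insert_of_notMem hv, Finset.prod_insert hv]
  ring

open Classical in
theorem indepSum_insert [DecidableEq V] (hv : v ∉ W) (x : V → ℝ) :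
    indepSum G (insert v W) x = ∑ I ∈ indepSets G W,
      if ∀ u ∈ I, ¬ G.Adj v u then (1 - x v) * indepTerm x I else indepTerm x I := by
  simp only [indepSum, indepSets, Finset.sum_filter]
  rw [Finset.sum_powerset_insert hv, ← Finset.sum_add_distrib]
  refine Finset.sum_congr rfl fun I hI => ?_
  have hvI : v ∉ I := fun h => hv (Finset.mem_powerset.1 hI h)
  have hindep : G.IsIndepSet (insert v I : Finset V) ↔
      G.IsIndepSet (I : Set V) ∧ ∀ u ∈ I, ¬ G.Adj v u := by
    have : Std.Symm fun a b => ¬ G.Adj a b := ⟨fun _ _ h h' => h h'.symm⟩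
    rw [Finset.coe_insert]
    exact Set.pairwise_insert_of_symm_of_notMem hvI
  rw [indepTerm_insert hvI]
  by_cases hI : G.IsIndepSet (I : Set V) <;> by_cases hadj : ∀ u ∈ I, ¬ G.Adj v u
  · rw [if_pos hI, if_pos (hindep.2 ⟨hI, hadj⟩), if_pos hI, if_pos hadj]
    ring
  all_goals simp [-Finset.coe_insert, hindep, hI, hadj]

theorem indepSum_singleton (v : V) (x : V → ℝ) : indepSum G {v} x = 1 - x v := by
  classical
  rw [← insert_empty_eq, indepSum_insert (Finset.notMem_empty v)]
  simp [indepSets, indepTerm, Finset.sum_filter]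

theorem eliminate_nonneg (hx : 0 ≤ x) (hv : x v < 1) : 0 ≤ eliminate G v x := by
  intro u
  rw [eliminate]
  split_ifs
  exacts [div_nonneg (hx u) (sub_nonneg.2 hv.le), hx u]

theorem eliminate_mono {w : V → ℝ} (hx : 0 ≤ x) (hwx : w ≤ x) (hv : x v < 1) :
    eliminate G v w ≤ eliminate G v x := by
  intro u
  simp only [eliminate]
  split_ifs
  exacts [div_le_div₀ (hx u) (hwx u) (by linarith) (by linarith [hwx v]), hwx u]

theorem indepTerm_eliminate_of_forall_not_adj {I : Finset V} (hI : ∀ u ∈ I, ¬ G.Adj v u) :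
    indepTerm (eliminate G v x) I = indepTerm x I :=
  indepTerm_congr fun u hu => if_neg (hI u hu)

theorem indepTerm_eliminate_of_adj {I : Finset V} {u : V} (hu : u ∈ I)
    (hvu : G.Adj v u) (hI : ∀ w ∈ I, w ≠ u → ¬ G.Adj v w) :
    indepTerm (eliminate G v x) I = indepTerm x I / (1 - x v) := by
  classical
  obtain ⟨J, huJ, rfl⟩ : ∃ J, u ∉ J ∧ insert u J = I :=
    ⟨I.erase u, I.notMem_erase u, Finset.insert_erase hu⟩
  have hJ (w) (hw : w ∈ J) : ¬ G.Adj v w :=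
    hI w (Finset.mem_insert_of_mem hw) fun h => huJ (h ▸ hw)
  rw [indepTerm_insert huJ, indepTerm_insert huJ, indepTerm_eliminate_of_forall_not_adj hJ,
    eliminate, if_pos hvu]
  ring

theorem indepSum_insert_of_simplicial [DecidableEq V] (hv : v ∉ W) (hs : IsSimplicialIn G W v)
    (hx : x v ≠ 1) :
    indepSum G (insert v W) x = (1 - x v) * indepSum G W (eliminate G v x) := by
  have hx' : 1 - x v ≠ 0 := sub_ne_zero.2 hx.symm
  rw [indepSum_insert hv, indepSum, Finset.mul_sum]
  refine Finset.sum_congr rfl fun I hI => ?_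
  obtain ⟨hIW, hI⟩ := mem_indepSets.1 hI
  split_ifs with hadj
  · rw [indepTerm_eliminate_of_forall_not_adj hadj]
  · push Not at hadj
    obtain ⟨u, hu, hvu⟩ := hadj
    -- The neighbors of `v` in `W` form a clique, so `u` is the only one in `I`.
    have huniq (w) (hw : w ∈ I) (hwu : w ≠ u) : ¬ G.Adj v w := fun hvw =>
      hI hw hu hwu (hs ⟨hIW hw, hvw⟩ ⟨hIW hu, hvu⟩ hwu)
    rw [indepTerm_eliminate_of_adj hu hvu huniq, mul_div_cancel₀ _ hx']

theorem PositiveBelow.lt_one [DecidableEq V] (hv : v ∉ W) (hx : 0 ≤ x)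
    (h : PositiveBelow G (insert v W) x) : x v < 1 := by
  classical
  by_contra! hxv
  have hle : Pi.single v 1 ≤ x := fun u => by
    rcases eq_or_ne u v with rfl | hu
    · simpa using hxv
    · simpa [hu] using hx u
  have hpos := h (Pi.single v 1) (Pi.single_nonneg.2 zero_le_one) hle
  rw [indepSum_insert hv] at hpos
  refine hpos.ne' (Finset.sum_eq_zero fun I hI => ?_)
  have hvI : v ∉ I := fun h => hv ((mem_indepSets.1 hI).1 h)
  rcases I.eq_empty_or_nonempty with rfl | ⟨u, hu⟩
  · simp
  · have huv : u ≠ v := fun h => hvI (h ▸ hu)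
    have hzero : indepTerm (Pi.single v 1) I = 0 := by
      rw [indepTerm, Finset.prod_eq_zero hu (Pi.single_eq_of_ne huv 1), mul_zero]
    simp [hzero]

theorem positiveBelow_insert_iff [DecidableEq V] (hv : v ∉ W) (hs : IsSimplicialIn G W v)
    (hx : 0 ≤ x) :
    PositiveBelow G (insert v W) x ↔ x v < 1 ∧ PositiveBelow G W (eliminate G v x) := by
  classical
  refine ⟨fun h => ⟨h.lt_one hv hx, fun w hw hwx => ?_⟩, fun ⟨hxv, h⟩ w hw hwx => ?_⟩
  · have hxv : 0 < 1 - x v := sub_pos.2 (h.lt_one hv hx)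
    -- `y` is below `x` and its elimination is `w`.
    let y : V → ℝ := fun u => if u = v then x v else if G.Adj v u then w u * (1 - x v) else w u
    have hyv : y v = x v := if_pos rfl
    have hy : 0 ≤ y := fun u => by
      simp only [y]
      split_ifs
      exacts [hx v, mul_nonneg (hw u) hxv.le, hw u]
    have hyx : y ≤ x := fun u => by
      have hu := hwx u
      simp only [y]
      rw [eliminate] at hu
      split_ifs at hu ⊢ with huv hadj hadj
      exacts [huv ▸ le_rfl, huv ▸ le_rfl, (le_div_iff₀ hxv).1 hu, hu]
    have hyw : ∀ u ∈ W, eliminate G v y u = w u := fun u hu => by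
      have huv : u ≠ v := fun h => hv (h ▸ hu)
      simp only [eliminate, hyv, y, if_neg huv]
      split_ifs
      exacts [mul_div_cancel_right₀ _ hxv.ne', rfl]
    have hpos := h y hy hyx
    rw [indepSum_insert_of_simplicial hv hs (by linarith), hyv, indepSum_congr hyw] at hpos
    exact pos_of_mul_pos_right hpos hxv.le
  · have hwv : w v < 1 := (hwx v).trans_lt hxv
    rw [indepSum_insert_of_simplicial hv hs hwv.ne]
    exact mul_pos (sub_pos.2 hwv) (h _ (eliminate_nonneg hw hwv) (eliminate_mono hx hwx hxv))

end IndepSum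

/-! ### Strategies that are played in rounds -/

section Rounds

/-- A round of a strategy for the hat guessing game. The participants, which form a clique, add up
the last digits of their colors in base `modulus`: the pivot bets that the residue of the sum is
less than `guess`, and the followers bet that it is not. Afterwards they drop these digits. -/
structure Round (V : Type*) where
  pivot : V
  followers : Finset V
  modulus : ℕ
  guess : ℕ

variable {V : Type*}

/-- The rules for a round of a strategy for the hat guessing game on `G`. -/
structure Round.IsLegal (G : SimpleGraph V) (ρ : Round V) : Prop where
  isClique : G.IsClique {u | u = ρ.pivot ∨ u ∈ ρ.followers}
  pivot_notMem : ρ.pivot ∉ ρ.followers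
  guess_le : ρ.guess ≤ ρ.modulus
  modulus_pos : 0 < ρ.modulus

/-- The rules for a list of rounds: a vertex does not participate any more after it has been a
pivot. -/
structure IsLegal (G : SimpleGraph V) (L : List (Round V)) : Prop where
  round {ρ : Round V} : ρ ∈ L → ρ.IsLegal G
  pairwise : L.Pairwise fun ρ ρ' => ρ'.pivot ≠ ρ.pivot ∧ ρ.pivot ∉ ρ'.followers

theorem IsLegal.tail {G : SimpleGraph V} {ρ : Round V} {L : List (Round V)}
    (h : IsLegal G (ρ :: L)) : IsLegal G L :=
  ⟨fun hρ => h.round (List.mem_cons_of_mem _ hρ), h.pairwise.of_cons⟩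

variable [DecidableEq V]

namespace Round

/-- The base of the digit that a vertex contributes to a round; for a vertex that does not
participate this is the digit `0` in base `1`. -/
def radix (ρ : Round V) (u : V) : ℕ := if u = ρ.pivot ∨ u ∈ ρ.followers then ρ.modulus else 1

/-- The least residue on which a vertex bets in a round. -/
def lo (ρ : Round V) (u : V) : ℕ := if u ∈ ρ.followers then ρ.guess else 0

/-- The upper bound of the residues on which a vertex bets in a round. -/
def hi (ρ : Round V) (u : V) : ℕ :=
  if u = ρ.pivot then ρ.guess else if u ∈ ρ.followers then ρ.modulus else 1

/-- The number of residues on which a vertex bets in a round. -/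
def bet (ρ : Round V) (u : V) : ℕ := ρ.hi u - ρ.lo u

/-- The colors without the digits that are used up in a round. -/
def quotient (ρ : Round V) (c : V → ℕ) (u : V) : ℕ := c u / ρ.radix u

/-- The vertex `v` wins its bet in a round if the colors are `c`. -/
def Passes [Fintype V] (ρ : Round V) (c : V → ℕ) (v : V) : Prop :=
  (∑ u, c u % ρ.radix u) % ρ.radix v ∈ Set.Ico (ρ.lo v) (ρ.hi v)

variable {G : SimpleGraph V} {ρ : Round V} {u v : V}

theorem radix_of_notMem (hp : u ≠ ρ.pivot) (hf : u ∉ ρ.followers) : ρ.radix u = 1 :=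
  if_neg (by tauto)

theorem bet_of_notMem (hp : u ≠ ρ.pivot) (hf : u ∉ ρ.followers) : ρ.bet u = 1 := by
  rw [bet, hi, if_neg hp, if_neg hf, lo, if_neg hf]

theorem IsLegal.radix_pos (hρ : ρ.IsLegal G) (u : V) : 0 < ρ.radix u := by
  rw [radix]
  split_ifs
  exacts [hρ.modulus_pos, one_pos]

theorem IsLegal.hi_le_radix (hρ : ρ.IsLegal G) (u : V) : ρ.hi u ≤ ρ.radix u := by
  have := hρ.guess_le
  rw [hi, radix]
  split_ifs <;> first | omega | tauto

variable [Fintype V] {c c' : V → ℕ}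

theorem passes_of_notMem (c : V → ℕ) (hp : v ≠ ρ.pivot) (hf : v ∉ ρ.followers) :
    ρ.Passes c v := by
  simp [Passes, radix_of_notMem hp hf, lo, hi, hp, hf, Nat.mod_one]

theorem IsLegal.passes_of_not_passes_pivot (hρ : ρ.IsLegal G) (h : ¬ ρ.Passes c ρ.pivot)
    (hv : v ≠ ρ.pivot) : ρ.Passes c v := by
  by_cases hf : v ∈ ρ.followers
  · have hlt := Nat.mod_lt (∑ u, c u % ρ.radix u) hρ.modulus_pos
    simp only [Passes, radix, lo, hi, hρ.pivot_notMem, hv, hf, Set.mem_Ico, if_true, if_false,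
      true_or, or_true, Nat.zero_le, true_and, not_lt] at h hlt ⊢
    exact ⟨h, hlt⟩
  · exact passes_of_notMem c hv hf

theorem IsLegal.passes_congr (hρ : ρ.IsLegal G) (h : ∀ u, u = v ∨ G.Adj v u → c u = c' u) :
    ρ.Passes c v ↔ ρ.Passes c' v := by
  by_cases hv : v = ρ.pivot ∨ v ∈ ρ.followers
  · have hsum : ∑ u, c u % ρ.radix u = ∑ u, c' u % ρ.radix u :=
      Finset.sum_congr rfl fun u _ => by
        by_cases hu : u = ρ.pivot ∨ u ∈ ρ.followers
        · rw [h u (or_iff_not_imp_left.2 fun huv => hρ.isClique hv hu (Ne.symm huv))]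
        · rw [radix, if_neg hu, Nat.mod_one, Nat.mod_one]
    rw [Passes, Passes, hsum]
  · rw [not_or] at hv
    exact iff_of_true (passes_of_notMem c hv.1 hv.2) (passes_of_notMem c' hv.1 hv.2)

end Round

/-- The number of colors of `u` in the strategy with rounds `L`. -/
def colors (L : List (Round V)) (u : V) : ℕ := (L.map fun ρ => ρ.radix u).prod

/-- The number of guesses of `u` in the strategy with rounds `L`. -/
def guesses (L : List (Round V)) (u : V) : ℕ := (L.map fun ρ => ρ.bet u).prod

theorem colors_append_singleton (L : List (Round V)) (ρ : Round V) (u : V) :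
    colors (L ++ [ρ]) u = colors L u * ρ.radix u := by
  simp [colors]

theorem guesses_append_singleton (L : List (Round V)) (ρ : Round V) (u : V) :
    guesses (L ++ [ρ]) u = guesses L u * ρ.bet u := by
  simp [guesses]

/-- In the strategy with rounds `L`, the vertex `v` guesses its own color, that is, it wins all its
bets if the colors are `c`. -/
def Guesses [Fintype V] : List (Round V) → (V → ℕ) → V → Prop
  | [], _, _ => True
  | ρ :: L, c, v => ρ.Passes c v ∧ Guesses L (ρ.quotient c) v

variable {G : SimpleGraph V} {L : List (Round V)} {ρ : Round V} {v : V}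

theorem IsLegal.colors_pos (hL : IsLegal G L) (u : V) : 0 < colors L u :=
  List.prod_pos fun _ h => by
    obtain ⟨ρ, hρ, rfl⟩ := List.mem_map.1 h
    exact (hL.round hρ).radix_pos u

theorem IsLegal.guesses_le_colors (hL : IsLegal G L) (u : V) : guesses L u ≤ colors L u :=
  List.Forall₂.prod_le_prod' <| List.forall₂_map_left_iff.2 <| List.forall₂_map_right_iff.2 <|
    List.forall₂_same.2 fun _ hρ => (Nat.sub_le _ _).trans ((hL.round hρ).hi_le_radix u)

variable [Fintype V]

/-! ### Winning -/

theorem guesses_of_forall_notMem (h : ∀ ρ ∈ L, v ≠ ρ.pivot ∧ v ∉ ρ.followers) (c : V → ℕ) :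
    Guesses L c v := by
  induction L generalizing c with
  | nil => trivial
  | cons ρ L ih =>
    rw [List.forall_mem_cons] at h
    exact ⟨Round.passes_of_notMem c h.1.1 h.1.2, ih h.2 _⟩

theorem IsLegal.exists_guesses_pivot (hL : IsLegal G L)
    (hsure : ∃ ρ ∈ L, ρ.modulus ≤ ρ.guess) (c : V → ℕ) : ∃ ρ ∈ L, Guesses L c ρ.pivot := by
  induction L generalizing c with
  | nil => simp at hsure
  | cons ρ L ih =>
    have hρ := hL.round List.mem_cons_self
    have hlater {ρ' : Round V} (h : ρ' ∈ L) := List.rel_of_pairwise_cons hL.pairwise h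
    by_cases hpass : ρ.Passes c ρ.pivot
    · exact ⟨ρ, List.mem_cons_self, hpass,
        guesses_of_forall_notMem (fun ρ' h => ⟨(hlater h).1.symm, (hlater h).2⟩) _⟩
    -- All the others win their bets in this round, so it suffices that one of them wins the rest.
    · have hlt : ρ.guess < ρ.modulus := by
        by_contra! hle
        have := Nat.mod_lt (∑ u, c u % ρ.radix u) hρ.modulus_pos
        refine hpass ?_
        simp only [Round.Passes, Round.radix, Round.lo, Round.hi, hρ.pivot_notMem, true_or, if_true,
          if_false, Set.mem_Ico, Nat.zero_le, true_and]
        exact this.trans_le hle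
      obtain ⟨ρ', hρ', h⟩ := ih hL.tail (by simpa [hlt.not_ge] using hsure) (ρ.quotient c)
      exact ⟨ρ', List.mem_cons_of_mem _ hρ',
        hρ.passes_of_not_passes_pivot hpass (hlater hρ').1, h⟩

/-! ### The number of guesses -/

theorem card_filter_mod_div {m n : ℕ} (hm : 0 < m) (P Q : ℕ → Prop) [DecidablePred P]
    [DecidablePred Q] :
    ((Finset.range (m * n)).filter fun a => P (a % m) ∧ Q (a / m)).card =
      ((Finset.range m).filter P).card * ((Finset.range n).filter Q).card := by
  rw [← Finset.card_product]
  refine Finset.card_nbij' (fun a => (a % m, a / m)) (fun b => b.1 + m * b.2) ?_ ?_ ?_ ?_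
  · intro a ha
    simp only [Finset.coe_filter, Finset.mem_range, Set.mem_ofPred_eq] at ha
    simpa [Nat.mod_lt a hm, Nat.div_lt_of_lt_mul ha.1] using ha.2
  · rintro ⟨i, j⟩ hb
    simp only [Finset.coe_product, Finset.coe_filter, Finset.mem_range, Set.mem_prod,
      Set.mem_ofPred_eq] at hb
    obtain ⟨⟨hi, hP⟩, hj, hQ⟩ := hb
    simp only [Finset.coe_filter, Finset.mem_range, Set.mem_ofPred_eq, Nat.add_mul_mod_self_left,
      Nat.mod_eq_of_lt hi, Nat.add_mul_div_left _ _ hm, Nat.div_eq_of_lt hi, zero_add]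
    exact ⟨by nlinarith, hP, hQ⟩
  · exact fun a _ => Nat.mod_add_div a m
  · rintro ⟨i, j⟩ hb
    have hi : i < m :=
      Finset.mem_range.1 (Finset.mem_filter.1 (Finset.mem_product.1 (Finset.mem_coe.1 hb)).1).1
    simp [Nat.mod_eq_of_lt hi, Nat.add_mul_div_left _ _ hm, Nat.div_eq_of_lt hi]

theorem card_filter_add_mod {m lo hi : ℕ} (hm : hi ≤ m) (k : ℕ) :
    ((Finset.range m).filter fun a => (k + a) % m ∈ Set.Ico lo hi).card = hi - lo := by
  calc _ = ((Finset.Ico k (k + m)).filter fun a => a % m ∈ Set.Ico lo hi).card := by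
        have hmap := Finset.map_add_left_Ico 0 m k
        rw [add_zero] at hmap
        rw [← hmap, Finset.filter_map, Finset.card_map, Finset.range_eq_Ico]
        rfl
    _ = ((Finset.range m).filter fun a => a % m ∈ Set.Ico lo hi).card := by
        rw [Nat.filter_Ico_card_eq_of_periodic k m _ fun a => by simp,
          Nat.count_eq_card_filter_range]
    _ = (Finset.Ico lo hi).card := congrArg _ (by
        ext a
        simp only [Finset.mem_filter, Finset.mem_range, Set.mem_Ico, Finset.mem_Ico]
        constructor
        · rintro ⟨ha, h⟩
          rwa [Nat.mod_eq_of_lt ha] at h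
        · intro h
          have ha : a < m := h.2.trans_le hm
          rw [Nat.mod_eq_of_lt ha]
          exact ⟨ha, h⟩)
    _ = hi - lo := Nat.card_Ico lo hi

theorem IsLegal.card_filter_guesses (hL : IsLegal G L) (c : V → ℕ) (v : V)
    [DecidablePred fun a => Guesses L (Function.update c v a) v] :
    ((Finset.range (colors L v)).filter fun a => Guesses L (Function.update c v a) v).card =
      guesses L v := by
  classical
  induction L generalizing c with
  | nil => simp [colors, guesses, Guesses]
  | cons ρ L ih =>
    have hρ := hL.round List.mem_cons_self
    have hquotient (a : ℕ) : ρ.quotient (Function.update c v a) =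
        Function.update (ρ.quotient c) v (a / ρ.radix v) := by
      funext u
      by_cases hu : u = v
      · subst hu; simp [Round.quotient]
      · simp [Round.quotient, hu]
    have hpasses (a : ℕ) : ρ.Passes (Function.update c v a) v ↔
        ((∑ u ∈ Finset.univ.erase v, c u % ρ.radix u) + a % ρ.radix v) % ρ.radix v ∈
          Set.Ico (ρ.lo v) (ρ.hi v) := by
      rw [Round.Passes, ← Finset.sum_erase_add _ _ (Finset.mem_univ v), Function.update_self,
        Finset.sum_congr rfl fun u hu => by
          rw [Function.update_of_ne (Finset.ne_of_mem_erase hu)]]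
    calc _ = _ := by
          simp only [Guesses, hpasses, hquotient, colors, List.map_cons, List.prod_cons]
          exact card_filter_mod_div (hρ.radix_pos v)
            (fun b => (∑ u ∈ Finset.univ.erase v, c u % ρ.radix u + b) % ρ.radix v ∈
              Set.Ico (ρ.lo v) (ρ.hi v))
            fun b => Guesses L (Function.update (ρ.quotient c) v b) v
      _ = _ := by
          rw [card_filter_add_mod (hρ.hi_le_radix v)]
          exact congrArg _ (ih hL.tail _)

/-! ### The strategy -/

theorem IsLegal.guesses_congr {c c' : V → ℕ} (hL : IsLegal G L)
    (h : ∀ u, u = v ∨ G.Adj v u → c u = c' u) : Guesses L c v ↔ Guesses L c' v := by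
  induction L generalizing c c' with
  | nil => exact Iff.rfl
  | cons ρ L ih =>
    exact and_congr ((hL.round List.mem_cons_self).passes_congr h)
      (ih hL.tail fun u hu => congrArg (· / ρ.radix u) (h u hu))

open Classical in
/-- The hat colors seen from `v`, and `0` for the vertices that are not seen. -/
noncomputable def seen {h : V → ℕ} {v : V} (c : View G h v) (u : V) : ℕ :=
  if hu : G.Adj v u then c ⟨u, hu⟩ else 0

open Classical in
/-- The strategy with rounds `L`. -/
noncomputable def strategy (hL : IsLegal G L) : Strategy G (colors L) (guesses L) := fun v c =>
  ⟨Finset.univ.filter fun a => Guesses L (Function.update (seen c) v a) v, by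
    rw [← hL.card_filter_guesses (seen c) v, Finset.card_filter, Finset.card_filter,
      Finset.sum_range]⟩

theorem isWinning_strategy (hL : IsLegal G L) (hsure : ∃ ρ ∈ L, ρ.modulus ≤ ρ.guess) :
    (strategy hL).IsWinning := by
  classical
  intro φ
  obtain ⟨ρ, -, hguess⟩ := hL.exists_guesses_pivot hsure fun u => φ u
  refine ⟨ρ.pivot, Finset.mem_filter.2 ⟨Finset.mem_univ _, (hL.guesses_congr ?_).1 hguess⟩⟩
  intro u hu
  by_cases huv : u = ρ.pivot
  · subst huv; simp
  · simp [seen, huv, hu.resolve_left huv]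

end Rounds

/-! ### States of the elimination -/

section State

variable {V : Type*}

/-- A state of the elimination: the remaining vertices `u` have weights `weight u / scale`. -/
structure State (V : Type*) where
  remaining : Finset V
  scale : ℕ
  weight : V → ℕ

namespace State

variable [DecidableEq V] {G : SimpleGraph V} {v : V}

open Classical in
/-- The state after the elimination of `v`. If `v` has weight at least `1`, then the new weights are
meaningless, but this does no harm. -/
noncomputable def step (G : SimpleGraph V) (s : State V) (v : V) : State V where
  remaining := s.remaining.erase v
  scale := max (s.scale - s.weight v) 1
  weight u := if G.Adj v u then s.weight u else s.weight u * (s.scale - s.weight v) / s.scale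

open Classical in
/-- The round of the strategy that corresponds to the elimination of `v`. -/
noncomputable def round (G : SimpleGraph V) (s : State V) (v : V) : Round V where
  pivot := v
  followers := s.remaining.filter fun u => G.Adj v u
  modulus := s.scale
  guess := min s.scale (s.weight v)

theorem bet_round_self_le (s : State V) (v : V) : (s.round G v).bet v ≤ s.weight v := by
  simp [Round.bet, Round.hi, Round.lo, State.round]

/-- The product of the ratio of guesses to colors with the weight does not increase. -/
theorem bet_round_mul_weight_step_le (s : State V) {u : V} (huv : u ≠ v) (hu : u ∈ s.remaining) :
    (s.round G v).bet u * (s.step G v).weight u * s.scale ≤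
      s.weight u * (s.round G v).radix u * (s.step G v).scale := by
  classical
  have hpivot : u ≠ (s.round G v).pivot := huv
  by_cases hadj : G.Adj v u
  · have hf : u ∈ (s.round G v).followers := Finset.mem_filter.2 ⟨hu, hadj⟩
    have hbet : (s.round G v).bet u ≤ (s.step G v).scale := by
      rw [Round.bet, Round.hi, if_neg hpivot, if_pos hf, Round.lo, if_pos hf]
      simp only [State.round, State.step]
      omega
    have hweight : (s.step G v).weight u = s.weight u := if_pos hadj
    rw [Round.radix, if_pos (.inr hf), hweight]
    calc (s.round G v).bet u * s.weight u * s.scale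
        ≤ (s.step G v).scale * s.weight u * s.scale := by gcongr
      _ = s.weight u * s.scale * (s.step G v).scale := by ring
  · have hf : u ∉ (s.round G v).followers := fun hf => hadj (Finset.mem_filter.1 hf).2
    rw [Round.radix_of_notMem hpivot hf, Round.bet_of_notMem hpivot hf, one_mul, mul_one]
    simp only [State.step, if_neg hadj]
    exact (Nat.div_mul_le_self _ _).trans (by gcongr; exact le_max_left _ _)

end State

end State

/-! ### Elimination of simplicial vertices -/

section Elimination

variable {V : Type*} [Fintype V]

/-- A common denominator of the entries of `r`. -/
def commonDen (r : V → ℚ≥0) : ℕ := ∏ v, (r v).den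

theorem commonDen_pos (r : V → ℚ≥0) : 0 < commonDen r :=
  Finset.prod_pos fun v _ => (r v).den_pos

theorem den_dvd_commonDen (r : V → ℚ≥0) (v : V) : (r v).den ∣ commonDen r :=
  Finset.dvd_prod_of_mem _ (Finset.mem_univ v)

theorem exists_int_eq_commonDen_mul_indepSum {G : SimpleGraph V} (r : V → ℚ≥0) (A : Finset V) :
    ∃ k : ℤ, commonDen r * indepSum G A (fun v => (r v : ℝ)) = k := by
  classical
  refine ⟨∑ I ∈ indepSets G A, (-1) ^ I.card * ((∏ v ∈ I, (r v).num) * ∏ v ∈ Iᶜ, (r v).den), ?_⟩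
  push_cast
  rw [indepSum, Finset.mul_sum]
  refine Finset.sum_congr rfl fun I _ => ?_
  have hr (v : V) : ((r v).den : ℝ) * (r v : ℝ) = (r v).num := by
    exact_mod_cast (r v).den_mul_eq_num
  calc (commonDen r : ℝ) * indepTerm (fun v => (r v : ℝ)) I
      = (-1) ^ I.card * (((∏ v ∈ I, ((r v).den : ℝ)) * ∏ v ∈ I, (r v : ℝ)) *
          ∏ v ∈ Iᶜ, ((r v).den : ℝ)) := by
        rw [commonDen, ← Finset.prod_mul_prod_compl I, indepTerm]
        push_cast
        ring
    _ = _ := by rw [← Finset.prod_mul_distrib, Finset.prod_congr rfl fun v _ => hr v]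

variable [DecidableEq V] {G : SimpleGraph V}

/-- The vertices outside `W` have been eliminated, which has changed the weights of the others from
`r` to `x`. -/
structure Reduces (G : SimpleGraph V) (r : V → ℝ) (W : Finset V) (x : V → ℝ) : Prop where
  nonneg : 0 ≤ x
  factor {A : Finset V} : A ⊆ W → indepSum G (Wᶜ ∪ A) r = indepSum G Wᶜ r * indepSum G A x
  positiveBelow_iff : PositiveBelow G Finset.univ r ↔ PositiveBelow G W x

namespace Reduces

variable {r x : V → ℝ} {W : Finset V} {u v : V}

theorem univ (hr : 0 ≤ r) : Reduces G r Finset.univ r :=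
  ⟨hr, fun _ => by simp, Iff.rfl⟩

theorem indepSum_compl_erase (h : Reduces G r W x) (hv : v ∈ W) :
    indepSum G (W.erase v)ᶜ r = indepSum G Wᶜ r * (1 - x v) := by
  rw [Finset.compl_erase, Finset.insert_eq, Finset.union_comm,
    h.factor (Finset.singleton_subset_iff.2 hv), indepSum_singleton]

protected theorem eliminate (h : Reduces G r W x) (hv : v ∈ W) (hs : IsSimplicialIn G W v)
    (hx : x v < 1) : Reduces G r (W.erase v) (eliminate G v x) where
  nonneg := eliminate_nonneg h.nonneg hx
  factor {A} hA := by
    have hvA : v ∉ A := fun hvA => Finset.notMem_erase v W (hA hvA)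
    have hAW : A ⊆ W := hA.trans (Finset.erase_subset v W)
    have hsA : IsSimplicialIn G A v := hs.mono hAW
    calc indepSum G ((W.erase v)ᶜ ∪ A) r = indepSum G (Wᶜ ∪ insert v A) r := by
          rw [Finset.compl_erase, Finset.insert_union, Finset.union_insert]
      _ = indepSum G Wᶜ r * ((1 - x v) * indepSum G A (eliminate G v x)) := by
          rw [h.factor (Finset.insert_subset hv hAW), indepSum_insert_of_simplicial hvA hsA hx.ne]
      _ = indepSum G (W.erase v)ᶜ r * indepSum G A (eliminate G v x) := by
          rw [h.indepSum_compl_erase hv, mul_assoc]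
  positiveBelow_iff := by
    have := positiveBelow_insert_iff (Finset.notMem_erase v W) (hs.mono (W.erase_subset v)) h.nonneg
    rwa [Finset.insert_erase hv, and_iff_right hx, ← h.positiveBelow_iff] at this

end Reduces

variable {r : V → ℚ≥0}

theorem Reduces.exists_int_eq {W : Finset V} {x : V → ℝ} {u : V}
    (h : Reduces G (fun v => (r v : ℝ)) W x) (hu : u ∈ W) :
    ∃ k : ℤ, commonDen r * indepSum G Wᶜ (fun v => (r v : ℝ)) * x u = k := by
  obtain ⟨k, hk⟩ := exists_int_eq_commonDen_mul_indepSum (G := G) r Wᶜ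
  obtain ⟨l, hl⟩ := exists_int_eq_commonDen_mul_indepSum (G := G) r (W.erase u)ᶜ
  refine ⟨k - l, ?_⟩
  rw [h.indepSum_compl_erase hu] at hl
  push_cast
  rw [← hk, ← hl]
  ring

namespace State

/-- The state in which no vertex is eliminated and the weights are the entries of `r`. -/
def init (r : V → ℚ≥0) : State V where
  remaining := Finset.univ
  scale := commonDen r
  weight v := (r v).num * (commonDen r / (r v).den)

/-- The state represents the weights `x`, and its scale is the value of the signed independence
polynomial of the eliminated part, cleared of denominators. -/
structure Exact (G : SimpleGraph V) (r : V → ℚ≥0) (s : State V) (x : V → ℝ) : Prop where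
  reduces : Reduces G (fun v => (r v : ℝ)) s.remaining x
  scale_eq : (s.scale : ℝ) = commonDen r * indepSum G s.remainingᶜ fun v => (r v : ℝ)
  weight_eq {u : V} : u ∈ s.remaining → (s.weight u : ℝ) = s.scale * x u

variable {s : State V} {x : V → ℝ} {v : V}

theorem exact_init (r : V → ℚ≥0) : (init r).Exact G r fun v => (r v : ℝ) where
  reduces := .univ fun v => NNRat.cast_nonneg _
  scale_eq := by simp [init]
  weight_eq {u} _ := by
    have hden : ((r u).den : ℝ) ≠ 0 := Nat.cast_ne_zero.2 (r u).den_ne_zero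
    rw [init, Nat.cast_mul, Nat.cast_div (den_dvd_commonDen r u) hden, NNRat.cast_def (r u)]
    ring

theorem Exact.lt_one_iff (h : s.Exact G r x) (hscale : 0 < s.scale) (hv : v ∈ s.remaining) :
    x v < 1 ↔ s.weight v < s.scale := by
  have hscale' : (0 : ℝ) < s.scale := Nat.cast_pos.2 hscale
  rw [← Nat.cast_lt (α := ℝ), h.weight_eq hv, mul_lt_iff_lt_one_right hscale']

/-- By `Reduces.exists_int_eq`, the new weights are integers, so that the division has no
remainder. -/
theorem Exact.step (h : s.Exact G r x) (hscale : 0 < s.scale) (hv : v ∈ s.remaining)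
    (hs : IsSimplicialIn G s.remaining v) (hlt : s.weight v < s.scale) :
    (s.step G v).Exact G r (eliminate G v x) := by
  have hx : x v < 1 := (h.lt_one_iff hscale hv).2 hlt
  have hreduces := h.reduces.eliminate hv hs hx
  have hgap : ((s.scale - s.weight v : ℕ) : ℝ) = s.scale * (1 - x v) := by
    rw [Nat.cast_sub hlt.le, h.weight_eq hv]
    ring
  have hnew : ((s.step G v).scale : ℝ) = s.scale * (1 - x v) := by
    rw [← hgap, State.step, max_eq_left (by omega)]
  have hscale_eq : ((s.step G v).scale : ℝ) =
      commonDen r * indepSum G (s.remaining.erase v)ᶜ fun v => (r v : ℝ) := by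
    rw [hnew, h.reduces.indepSum_compl_erase hv, h.scale_eq, mul_assoc]
  refine ⟨hreduces, hscale_eq, fun {u} hu => ?_⟩
  have hu' : u ∈ s.remaining := Finset.mem_of_mem_erase hu
  obtain ⟨k, hk⟩ := hreduces.exists_int_eq hu
  rw [← hscale_eq, hnew] at hk
  by_cases hadj : G.Adj v u
  · have : 1 - x v ≠ 0 := by linarith
    rw [hnew]
    simp only [State.step, eliminate, if_pos hadj, h.weight_eq hu']
    field_simp
  · simp only [eliminate, if_neg hadj] at hk ⊢
    have hdvd : s.scale ∣ s.weight u * (s.scale - s.weight v) := by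
      rw [← Int.natCast_dvd_natCast]
      refine ⟨k, ?_⟩
      rw [← Int.cast_inj (α := ℝ)]
      push_cast
      rw [hgap, h.weight_eq hu', ← hk]
      ring
    have hscale' : (s.scale : ℝ) ≠ 0 := by exact_mod_cast hscale.ne'
    rw [hnew]
    simp only [State.step, if_neg hadj]
    rw [Nat.cast_div hdvd hscale', Nat.cast_mul, hgap, h.weight_eq hu']
    field_simp

end State

/-- Starting with the state `State.init r`, the elimination of remaining simplicial vertices leads
to the state `s`, and `L` is the list of the corresponding rounds. -/
inductive Eliminates (G : SimpleGraph V) (r : V → ℚ≥0) : List (Round V) → State V → Prop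
  | init : Eliminates G r [] (.init r)
  | step {L : List (Round V)} {s : State V} {v : V} : Eliminates G r L s → v ∈ s.remaining →
      IsSimplicialIn G s.remaining v → Eliminates G r (L ++ [s.round G v]) (s.step G v)

namespace Eliminates

variable {L : List (Round V)} {s : State V} {u : V}

theorem scale_pos (h : Eliminates G r L s) : 0 < s.scale := by
  cases h with
  | init => exact commonDen_pos r
  | step => exact lt_max_of_lt_right one_pos

theorem scale_le (h : Eliminates G r L s) : s.scale ≤ commonDen r := by
  induction h with
  | init => exact le_rfl
  | step _ _ _ ih => exact max_le ((Nat.sub_le _ _).trans ih) (commonDen_pos r)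

theorem weight_le (h : Eliminates G r L s) (u : V) : s.weight u ≤ (r u).num * commonDen r := by
  induction h with
  | init => exact Nat.mul_le_mul_left _ (Nat.div_le_self _ _)
  | @step _ s v _ _ _ ih =>
    refine le_trans ?_ ih
    simp only [State.step]
    split_ifs
    · exact le_rfl
    · exact Nat.div_le_of_le_mul (by rw [mul_comm]; gcongr; exact Nat.sub_le _ _)

theorem length_add_card_remaining (h : Eliminates G r L s) :
    L.length + s.remaining.card = Fintype.card V := by
  induction h with
  | init => simp [State.init]
  | @step _ s v _ hv _ ih =>
    have := Finset.card_pos.2 ⟨v, hv⟩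
    simp only [List.length_append, List.length_singleton, State.step, Finset.card_erase_of_mem hv]
    omega

theorem modulus_le (h : Eliminates G r L s) {ρ : Round V} (hρ : ρ ∈ L) :
    ρ.modulus ≤ commonDen r := by
  induction h with
  | init => simp at hρ
  | step h _ _ ih =>
    rcases List.mem_append.1 hρ with hρ | hρ
    · exact ih hρ
    · rw [List.mem_singleton.1 hρ]
      exact h.scale_le

theorem pivot_notMem_remaining (h : Eliminates G r L s) {ρ : Round V} (hρ : ρ ∈ L) :
    ρ.pivot ∉ s.remaining := by
  induction h with
  | init => simp at hρ
  | step _ _ _ ih =>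
    rcases List.mem_append.1 hρ with hρ | hρ
    · exact fun hmem => ih hρ (Finset.mem_of_mem_erase hmem)
    · rw [List.mem_singleton.1 hρ]
      exact Finset.notMem_erase _ _

theorem isLegal (h : Eliminates G r L s) : IsLegal G L := by
  classical
  induction h with
  | init => exact ⟨by simp, .nil⟩
  | @step L s v h hv hs ih =>
    refine ⟨fun {ρ} hρ => ?_, List.pairwise_append.2 ⟨ih.pairwise, List.pairwise_singleton _ _, ?_⟩⟩
    · rcases List.mem_append.1 hρ with hρ | hρ
      · exact ih.round hρ
      · rw [List.mem_singleton.1 hρ]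
        refine ⟨?_, by simp [State.round], min_le_left _ _, h.scale_pos⟩
        simp only [State.round, Finset.mem_filter]
        exact hs.insert fun u hu _ => hu.2
    · intro ρ hρ ρ' hρ'
      have := h.pivot_notMem_remaining hρ
      rw [List.mem_singleton.1 hρ']
      exact ⟨fun heq => this (heq ▸ hv), fun hmem => this (Finset.mem_filter.1 hmem).1⟩

/-! ### The ratios of guesses to colors -/

theorem colors_le (h : Eliminates G r L s) (u : V) : colors L u ≤ commonDen r ^ L.length := by
  rw [← List.length_map fun ρ : Round V => ρ.radix u]
  refine List.prod_le_pow_card _ _ fun x hx => ?_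
  obtain ⟨ρ, hρ, rfl⟩ := List.mem_map.1 hx
  rw [Round.radix]
  split_ifs
  exacts [h.modulus_le hρ, commonDen_pos r]

theorem guesses_mul_le (h : Eliminates G r L s) (u : V) :
    (u ∈ s.remaining → guesses L u * s.weight u * (r u).den ≤ (r u).num * colors L u * s.scale) ∧
      (u ∉ s.remaining → guesses L u * (r u).den ≤ (r u).num * colors L u) := by
  classical
  induction h with
  | init =>
    refine ⟨fun _ => ?_, fun hu => absurd (Finset.mem_univ u) hu⟩
    simp only [guesses, colors, State.init, List.map_nil, List.prod_nil, one_mul, mul_one,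
      mul_assoc, Nat.div_mul_cancel (den_dvd_commonDen r u), le_refl]
  | @step L s v h hv _ ih =>
    rw [guesses_append_singleton, colors_append_singleton]
    refine ⟨fun hu => Nat.le_of_mul_le_mul_right ?_ h.scale_pos, fun hu => ?_⟩
    · obtain ⟨huv, hu⟩ := Finset.mem_erase.1 hu
      calc guesses L u * (s.round G v).bet u * (s.step G v).weight u * (r u).den * s.scale
          = guesses L u * (r u).den * ((s.round G v).bet u * (s.step G v).weight u * s.scale) := by
            ring
        _ ≤ guesses L u * (r u).den *
            (s.weight u * (s.round G v).radix u * (s.step G v).scale) :=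
          Nat.mul_le_mul_left _ (s.bet_round_mul_weight_step_le huv hu)
        _ = guesses L u * s.weight u * (r u).den *
            ((s.round G v).radix u * (s.step G v).scale) := by ring
        _ ≤ (r u).num * colors L u * s.scale * ((s.round G v).radix u * (s.step G v).scale) :=
          Nat.mul_le_mul_right _ (ih.1 hu)
        _ = (r u).num * (colors L u * (s.round G v).radix u) * (s.step G v).scale * s.scale := by
            ring
    · by_cases huv : u = v
      · subst huv
        calc guesses L u * (s.round G u).bet u * (r u).den
            ≤ guesses L u * s.weight u * (r u).den := by
              gcongr
              exact s.bet_round_self_le u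
          _ ≤ (r u).num * colors L u * s.scale := ih.1 hv
          _ = (r u).num * (colors L u * (s.round G u).radix u) := by
              rw [Round.radix, if_pos (.inl rfl), mul_assoc]
              rfl
      · have hu : u ∉ s.remaining := fun hmem => hu (Finset.mem_erase.2 ⟨huv, hmem⟩)
        have hf : u ∉ (s.round G v).followers := fun hf => hu (Finset.mem_filter.1 hf).1
        rw [Round.radix_of_notMem huv hf, Round.bet_of_notMem huv hf, mul_one, mul_one]
        exact ih.2 hu

theorem guesses_div_colors_le (h : Eliminates G r L s) (hs : s.remaining = ∅) (u : V) :
    (guesses L u : ℚ≥0) / colors L u ≤ r u := by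
  have hle := (h.guesses_mul_le u).2 (by simp [hs])
  have hcolors : (0 : ℚ≥0) < colors L u := Nat.cast_pos.2 (h.isLegal.colors_pos u)
  have hden : (0 : ℚ≥0) < (r u).den := Nat.cast_pos.2 (r u).den_pos
  rw [div_le_iff₀ hcolors]
  refine le_of_mul_le_mul_right ?_ hden
  calc (guesses L u : ℚ≥0) * (r u).den ≤ (r u).num * colors L u := by exact_mod_cast hle
    _ = r u * colors L u * (r u).den := by
        rw [← (r u).den_mul_eq_num]
        ring

/-! ### Correctness of the decision -/

theorem exists_exact (h : Eliminates G r L s) (hlt : ∀ ρ ∈ L, ρ.guess < ρ.modulus) :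
    ∃ x, s.Exact G r x := by
  induction h with
  | init => exact ⟨_, State.exact_init r⟩
  | @step L s v h hv hs ih =>
    rw [List.forall_mem_append, List.forall_mem_singleton] at hlt
    obtain ⟨x, hx⟩ := ih hlt.1
    exact ⟨_, hx.step h.scale_pos hv hs (by simpa [State.round] using hlt.2)⟩

theorem not_positiveBelow (h : Eliminates G r L s) (hsure : ∃ ρ ∈ L, ρ.modulus ≤ ρ.guess) :
    ¬ PositiveBelow G Finset.univ fun v => (r v : ℝ) := by
  induction h with
  | init => simp at hsure
  | @step L s v h hv _ ih =>
    by_cases hL : ∃ ρ ∈ L, ρ.modulus ≤ ρ.guess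
    · exact ih hL
    have hle : s.scale ≤ s.weight v := by
      have : (s.round G v).modulus ≤ (s.round G v).guess := by
        obtain ⟨ρ, hρ, h⟩ := hsure
        rcases List.mem_append.1 hρ with hρ | hρ
        · exact absurd ⟨ρ, hρ, h⟩ hL
        · rwa [List.mem_singleton.1 hρ] at h
      simpa [State.round] using this
    push Not at hL
    obtain ⟨x, hx⟩ := h.exists_exact hL
    rw [hx.reduces.positiveBelow_iff, ← Finset.insert_erase hv]
    intro hpos
    exact hle.not_gt ((hx.lt_one_iff h.scale_pos hv).1
      (hpos.lt_one (Finset.notMem_erase _ _) hx.reduces.nonneg))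

theorem exists_modulus_le_guess_iff (h : Eliminates G r L s) (hs : s.remaining = ∅) :
    (∃ ρ ∈ L, ρ.modulus ≤ ρ.guess) ↔ (fun v => (r v : ℝ)) ∉ region G := by
  have hregion : (fun v => (r v : ℝ)) ∈ region G ↔
      PositiveBelow G Finset.univ fun v => (r v : ℝ) := by
    simp only [region, PositiveBelow, indepSum_univ, Set.mem_ofPred_eq, and_iff_right_iff_imp]
    exact fun _ v => NNRat.cast_nonneg _
  rw [hregion]
  refine ⟨h.not_positiveBelow, fun hneg => ?_⟩
  by_contra! hlt
  obtain ⟨x, hx⟩ := h.exists_exact hlt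
  refine hneg (hx.reduces.positiveBelow_iff.2 fun w _ _ => ?_)
  rw [hs, indepSum_empty]
  exact one_pos

end Eliminates

end Elimination

/-! ### The memory of the decision program -/

local notation "INPUT" => (0 : ℕ)
local notation "OUTPUT" => (1 : ℕ)
local notation "DESCRIPTION" => (2 : ℕ)
local notation "COLORS" => (3 : ℕ)
local notation "GUESSES" => (4 : ℕ)
local notation "WEIGHT" => (5 : ℕ)
local notation "ELIMINATED" => (6 : ℕ)
local notation "SCALE" => (7 : ℕ)
local notation "GAP" => (8 : ℕ)
local notation "PIVOT" => (9 : ℕ)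
local notation "FAILED" => (10 : ℕ)
local notation "BLOCKED" => (11 : ℕ)
local notation "INDEX" => (12 : ℕ)
local notation "VERTEX" => (13 : ℕ)
local notation "ROUND" => (14 : ℕ)

/-- The value of the scalar variable that is kept in cell `0` of array `A`. -/
abbrev cell (A : ℕ) : Expr := .read A 0

/-- The number of vertices. -/
abbrev order : Expr := .read INPUT 1

/-- An entry of the adjacency matrix. -/
def adjacent (u v : Expr) : Expr := .read INPUT (2 + u * order + v)

/-- The numerator of an entry of `r`. -/
def numerator (u : Expr) : Expr := .read INPUT (2 + order * order + u)

/-- The denominator of an entry of `r`. -/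
def denominator (u : Expr) : Expr := .read INPUT (2 + order * order + order + u)

section Decision

variable {n : ℕ} {G : SimpleGraph (Fin n)} {r : Fin n → ℚ≥0} {B N : ℕ} {s : Mem}

open Classical in
/-- The array `x` holds the input `(G, r)`. -/
structure IsInput (G : SimpleGraph (Fin n)) (r : Fin n → ℚ≥0) (x : ℕ → ℕ) : Prop where
  order : x 1 = n
  adj (u v : Fin n) : x (2 + u * n + v) = if G.Adj u v then 1 else 0
  num (u : Fin n) : x (2 + n * n + u) = (r u).num
  den (u : Fin n) : x (2 + n * n + n + u) = (r u).den

namespace IsInput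

variable {e e' : Expr} {u v : Fin n}

open Classical in
theorem eval_adjacent (h : IsInput G r (s INPUT)) (hu : e.eval s = u) (hv : e'.eval s = v) :
    (adjacent e e').eval s = if G.Adj u v then 1 else 0 := by
  simp only [adjacent, Expr.eval_read, Expr.eval_add, Expr.eval_mul, Expr.eval_ofNat, hu, hv,
    h.order, h.adj]

theorem eval_numerator (h : IsInput G r (s INPUT)) (hu : e.eval s = u) :
    (numerator e).eval s = (r u).num := by
  simp only [numerator, Expr.eval_read, Expr.eval_add, Expr.eval_mul, Expr.eval_ofNat, hu,
    h.order, h.num]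

theorem eval_denominator (h : IsInput G r (s INPUT)) (hu : e.eval s = u) :
    (denominator e).eval s = (r u).den := by
  simp only [denominator, Expr.eval_read, Expr.eval_add, Expr.eval_mul, Expr.eval_ofNat, hu,
    h.order, h.den]

end IsInput

/-- The numbers that occur in the elimination have at most `B` bits, and there are at most `N` of
them. -/
structure Fits (r : Fin n → ℚ≥0) (B N : ℕ) : Prop where
  length_le : 3 * n ^ 2 + 2 * n + 1 ≤ N
  lt_two_pow : N < 2 ^ B
  commonDen_pow_lt : commonDen r ^ (n + 1) < 2 ^ B
  num_mul_commonDen_lt (u : Fin n) : (r u).num * commonDen r < 2 ^ B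

namespace Fits

theorem order_le (h : Fits r B N) : n ≤ N := by
  have := h.length_le
  omega

theorem sq_order_le (h : Fits r B N) : n * n ≤ N := by
  have := h.length_le
  nlinarith

theorem one_lt (h : Fits r B N) : 1 < 2 ^ B := by
  have := h.length_le
  have := h.lt_two_pow
  omega

theorem commonDen_lt (h : Fits r B N) : commonDen r < 2 ^ B :=
  (Nat.le_self_pow n.succ_ne_zero _).trans_lt h.commonDen_pow_lt

end Fits

/-- The entries of the output that describe the strategy with rounds `L`. -/
def description (L : List (Round (Fin n))) : List ℕ :=
  L.flatMap fun ρ => List.ofFn ρ.radix ++ List.ofFn ρ.lo ++ List.ofFn ρ.hi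

/-- The memory holds the result of the elimination with rounds `L` and final state `S`. -/
structure Stores (G : SimpleGraph (Fin n)) (r : Fin n → ℚ≥0) (L : List (Round (Fin n)))
    (S : State (Fin n)) (s : Mem) : Prop where
  isInput : IsInput G r (s INPUT)
  scale : s SCALE 0 = S.scale
  weight (u : Fin n) : s WEIGHT u = S.weight u
  eliminated (u : Fin n) : s ELIMINATED u = if u ∈ S.remaining then 0 else 1
  colors_eq (u : Fin n) : s COLORS u = colors L u
  guesses_eq (u : Fin n) : s GUESSES u = guesses L u
  failed : s FAILED 0 ≠ 0 ↔ ∃ ρ ∈ L, ρ.modulus ≤ ρ.guess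
  listAt_description : listAt s DESCRIPTION = description L

theorem Stores.frame {L : List (Round (Fin n))} {S : State (Fin n)} {s' : Mem} {W : List ℕ}
    (h : Stores G r L S s) (hW : ∀ A ∈ [INPUT, DESCRIPTION, COLORS, GUESSES, WEIGHT, ELIMINATED,
      SCALE, FAILED], A ∉ W) (hframe : ∀ A ∉ W, s' A = s A) : Stores G r L S s' := by
  have heq (A : ℕ) (hA : A ∈ _) : s' A = s A := hframe A (hW A hA)
  simp only [List.forall_mem_cons] at heq
  obtain ⟨hinput, hdescription, hcolors, hguesses, hweight, heliminated, hscale, hfailed, -⟩ := heq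
  exact ⟨hinput ▸ h.isInput, hscale ▸ h.scale, hweight ▸ h.weight, heliminated ▸ h.eliminated,
    hcolors ▸ h.colors_eq, hguesses ▸ h.guesses_eq, hfailed ▸ h.failed,
    (listAt_congr hdescription).trans h.listAt_description⟩

/-! ### The initial state -/

/-- Computes the common denominator of the entries of `r`. -/
def computeScale : Prog :=
  .write SCALE 0 1 >>
  times INDEX order (.write SCALE 0 (cell SCALE * denominator (cell INDEX)))

/-- Sets up the initial state of the elimination. -/
def prepare : Prog :=
  computeScale >>
  times INDEX order (.write WEIGHT (cell INDEX)
    (numerator (cell INDEX) * (cell SCALE / denominator (cell INDEX)))) >>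
  times INDEX order (.write COLORS (cell INDEX) 1) >>
  times INDEX order (.write GUESSES (cell INDEX) 1)

theorem wp_computeScale (hfits : Fits r B N) (h : IsInput G r (s INPUT)) :
    Wp B N computeScale (fun s' => s' SCALE 0 = commonDen r) s := by
  have hfactor (u : Fin n) : s INPUT (2 + n * n + n + u) = (r u).den := h.den u
  let F (k : ℕ) : ℕ := ∏ i ∈ Finset.range k, s INPUT (2 + n * n + n + i)
  have hF : F n = commonDen r := by
    simp only [F, commonDen, Finset.prod_range, hfactor]
  refine wp_seq (wp_write (by simpa using hfits.one_lt) ?_)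
  refine wp_fold (n := n) (by simp) (by simp [h.order]) hfits.order_le F (by simp [F])
    (fun k hk => ?_) (fun k hk s' hframe hindex hscale => ?_) fun s' _ hscale => hscale.trans hF
  · refine lt_of_le_of_lt ?_ hfits.commonDen_lt
    rw [← hF]
    refine Finset.prod_le_prod_of_subset_of_one_le' (Finset.range_subset_range.2 hk)
      fun i hi _ => ?_
    rw [hfactor ⟨i, Finset.mem_range.1 hi⟩]
    exact (r _).den_pos
  · have hinput : s' INPUT = s INPUT := (hframe INPUT (by decide)).trans (by simp)
    have hden := IsInput.eval_denominator (e := cell INDEX) (u := ⟨k, hk⟩) (hinput ▸ h)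
      (by simpa using hindex)
    rw [Expr.eval_mul, hden, Expr.eval_read, Expr.eval_ofNat, hscale, ← hfactor]
    exact (Finset.prod_range_succ ..).symm

theorem wp_prepare (hfits : Fits r B N) (h : IsInput G r (s INPUT))
    (hs : ∀ A ≠ INPUT, ∀ i, s A i = 0) : Wp B N prepare (Stores G r [] (.init r)) s := by
  have hone (_ : Fin n) : 1 < 2 ^ B := hfits.one_lt
  refine wp_seq ((wp_computeScale hfits h).mono fun s₁ hs₁ hscale => ?_)
  have hinput₁ : IsInput G r (s₁ INPUT) := hs₁ INPUT (by decide) ▸ h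
  refine wp_seq (wp_fill (n := n) (by simp) hinput₁.order hfits.order_le (State.init r).weight
    (fun k => ?_) (fun k s' hframe hindex _ => ?_) fun s₂ hs₂ hweight => ?_)
  · exact (Eliminates.init (G := G).weight_le k).trans_lt (hfits.num_mul_commonDen_lt k)
  · have hinput : IsInput G r (s' INPUT) := hframe INPUT (by decide) ▸ hinput₁
    have hscale' : s' SCALE 0 = commonDen r := by rw [hframe SCALE (by decide), hscale]
    simp only [Expr.eval_mul, Expr.eval_div, hinput.eval_numerator (e := cell INDEX) hindex,
      hinput.eval_denominator (e := cell INDEX) hindex, Expr.eval_read, Expr.eval_ofNat, hscale',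
      State.init]
  have hinput₂ : IsInput G r (s₂ INPUT) := hs₂ INPUT (by decide) ▸ hinput₁
  refine wp_seq (wp_fill (n := n) (by simp) hinput₂.order hfits.order_le (fun _ => 1) hone (by simp)
    fun s₃ hs₃ hcolors => ?_)
  have hinput₃ : IsInput G r (s₃ INPUT) := hs₃ INPUT (by decide) ▸ hinput₂
  refine wp_fill (n := n) (by simp) hinput₃.order hfits.order_le (fun _ => 1) hone (by simp)
    fun s₄ hs₄ hguesses => ?_
  have hunchanged {A : ℕ} (hA : A ∉ [WEIGHT, COLORS, GUESSES, INDEX]) : s₄ A = s₁ A := by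
    simp only [List.mem_cons, List.not_mem_nil, or_false, not_or] at hA
    rw [hs₄ A (by simp [hA]), hs₃ A (by simp [hA]), hs₂ A (by simp [hA])]
  have hzero {A : ℕ} (hA : A ∉ [INPUT, SCALE, WEIGHT, COLORS, GUESSES, INDEX]) (i : ℕ) :
      s₄ A i = 0 := by
    simp only [List.mem_cons, List.not_mem_nil, or_false, not_or] at hA
    rw [hunchanged (by simp [hA]), hs₁ A (by
      simp [computeScale, times, writes_andThen, writes, hA]), hs A hA.1]
  exact {
    isInput := hs₄ INPUT (by decide) ▸ hinput₃
    scale := by rw [hunchanged (by decide), hscale]; rfl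
    weight u := by rw [hs₄ WEIGHT (by decide), hs₃ WEIGHT (by decide), hweight]
    eliminated u := by simp [hzero (A := ELIMINATED) (by decide), State.init]
    colors_eq u := by rw [hs₄ COLORS (by decide), hcolors]; rfl
    guesses_eq u := hguesses u
    failed := by simp [hzero (A := FAILED) (by decide)]
    listAt_description := by simp [listAt, hzero (A := DESCRIPTION) (by decide), description] }

end Decision

/-! ### The search for a simplicial vertex -/

/-- A test whether a vertex has not been eliminated. -/
def remaining (u : Expr) : Expr := 1 - .read ELIMINATED u

/-- A test whether `x` and `y` show that `v` is not simplicial. -/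
def obstructs (v x y : Expr) : Expr :=
  remaining x * adjacent v x * (remaining y * adjacent v y) * .ne x y * (1 - adjacent x y)

/-- Sets `BLOCKED` if the current vertex is not simplicial. -/
def checkSimplicial : Prog :=
  times INDEX (order * order) (.write BLOCKED 0
    (.ite (obstructs (cell VERTEX) (cell INDEX / order) (cell INDEX % order)) 1 (cell BLOCKED)))

/-- Sets `BLOCKED` to zero if the current vertex remains and is simplicial. -/
def checkVertex : Prog :=
  .write BLOCKED 0 (.read ELIMINATED (cell VERTEX)) >> checkSimplicial

/-- Sets `PIVOT` to a remaining simplicial vertex. -/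
def findPivot : Prog :=
  times VERTEX order
    (checkVertex >> .branch (cell BLOCKED) .skip (.write PIVOT 0 (cell VERTEX)))

/-- The vertices `x` and `y` witness that `v` is not simplicial in the graph induced by `W`. -/
def IsObstruction {V : Type*} (G : SimpleGraph V) (W : Finset V) (v x y : V) : Prop :=
  (x ∈ W ∧ G.Adj v x) ∧ (y ∈ W ∧ G.Adj v y) ∧ x ≠ y ∧ ¬ G.Adj x y

theorem isSimplicialIn_iff_forall_not_isObstruction {V : Type*} {G : SimpleGraph V} {W : Finset V}
    {v : V} : IsSimplicialIn G W v ↔ ∀ x y, ¬ IsObstruction G W v x y := by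
  simp only [IsSimplicialIn, SimpleGraph.isClique_iff, Set.Pairwise, IsObstruction, not_and,
    not_not]
  exact ⟨fun h x y hx hy => h hx hy, fun h x hx y hy => h x y hx hy⟩

section Pivot

variable {n : ℕ} {G : SimpleGraph (Fin n)} {r : Fin n → ℚ≥0} {B N : ℕ} {s : Mem}
  {L : List (Round (Fin n))} {S : State (Fin n)} {v : Fin n}

namespace Stores

variable {e e₁ e₂ : Expr} {u x y : Fin n}

theorem eval_remaining (h : Stores G r L S s) (hu : e.eval s = u) :
    (remaining e).eval s = if u ∈ S.remaining then 1 else 0 := by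
  simp only [remaining, Expr.eval_sub, Expr.eval_ofNat, Expr.eval_read, hu, h.eliminated]
  split_ifs <;> rfl

theorem eval_obstructs_eq_zero (h : Stores G r L S s) (hv : e.eval s = v) (hx : e₁.eval s = x)
    (hy : e₂.eval s = y) :
    (obstructs e e₁ e₂).eval s = 0 ↔ ¬ IsObstruction G S.remaining v x y := by
  simp only [obstructs, Expr.eval_mul, Expr.eval_sub, Expr.eval_ofNat, h.eval_remaining hx,
    h.eval_remaining hy, h.isInput.eval_adjacent hv hx, h.isInput.eval_adjacent hv hy,
    h.isInput.eval_adjacent hx hy, mul_eq_zero, Expr.eval_ne_eq_zero, hx, hy, Fin.val_inj]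
  rw [IsObstruction]
  split_ifs <;> simp_all

open Classical in
theorem wp_checkSimplicial (h : Stores G r L S s) (hfits : Fits r B N) (hv : s VERTEX 0 = v)
    (hblocked : s BLOCKED 0 < 2 ^ B) :
    Wp B N checkSimplicial
      (fun s' => s' BLOCKED 0 = if IsSimplicialIn G S.remaining v then s BLOCKED 0 else 1) s := by
  let P (i : Fin (n * n)) : Prop := IsObstruction G S.remaining v i.divNat i.modNat
  let F (k : ℕ) : ℕ := if ∀ i : Fin (n * n), i < k → ¬ P i then s BLOCKED 0 else 1
  refine wp_fold (n := n * n) (by simp) (by simp [h.isInput.order]) hfits.sq_order_le F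
    (by simp [F]) (fun k _ => ?_) (fun k hk s' hframe hindex hk' => ?_) fun s' _ hk' => ?_
  · simp only [F]
    split_ifs
    exacts [hblocked, hfits.one_lt]
  · have h' : Stores G r L S s' := h.frame (by decide) hframe
    have hvertex : (cell VERTEX).eval s' = v := (congrFun (hframe VERTEX (by decide)) 0).trans hv
    have hobstructs := h'.eval_obstructs_eq_zero (e₁ := cell INDEX / order)
      (e₂ := cell INDEX % order) (x := Fin.divNat ⟨k, hk⟩) (y := Fin.modNat ⟨k, hk⟩) hvertex
      (by simp [hindex, h'.isInput.order]) (by simp [hindex, h'.isInput.order])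
    have hnext : (∀ i : Fin (n * n), i < k + 1 → ¬ P i) ↔
        ¬ P ⟨k, hk⟩ ∧ ∀ i : Fin (n * n), i < k → ¬ P i := by
      simp only [Nat.lt_succ_iff_lt_or_eq, or_imp, forall_and]
      rw [and_comm]
      refine and_congr_left' ⟨fun h => h ⟨k, hk⟩ rfl, ?_⟩
      rintro h i rfl
      exact h
    rw [Expr.eval_ite, Expr.eval_read, Expr.eval_ofNat, hk']
    simp only [hobstructs, F, hnext]
    split_ifs <;> tauto
  · have hall : (∀ i, ¬ P i) ↔ IsSimplicialIn G S.remaining v := by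
      rw [isSimplicialIn_iff_forall_not_isObstruction, ← Prod.forall',
        finProdFinEquiv.symm.surjective.forall]
      rfl
    rw [hk']
    simp [F, hall]

theorem wp_checkVertex (h : Stores G r L S s) (hfits : Fits r B N) (hv : s VERTEX 0 = v) :
    Wp B N checkVertex
      (fun s' => s' BLOCKED 0 = 0 ↔ v ∈ S.remaining ∧ IsSimplicialIn G S.remaining v) s := by
  have heliminated : (Expr.read ELIMINATED (cell VERTEX)).eval s =
      if v ∈ S.remaining then 0 else 1 := by
    rw [← h.eliminated, ← hv]
    rfl
  have hlt : (if v ∈ S.remaining then 0 else 1) < 2 ^ B := by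
    split_ifs
    exacts [zero_le_one.trans_lt hfits.one_lt, hfits.one_lt]
  refine wp_seq ((wp_write (Q := fun s' => s' BLOCKED 0 = if v ∈ S.remaining then 0 else 1)
    (heliminated ▸ hlt) (by simp [← heliminated])).mono fun s₁ hs₁ h₁ => ?_)
  refine ((h.frame (by decide) hs₁).wp_checkSimplicial hfits
    ((congrFun (hs₁ VERTEX (by decide)) 0).trans hv) (h₁ ▸ hlt)).mono fun s₂ _ h₂ => ?_
  rw [h₂, h₁]
  split_ifs <;> simp_all

/-- In the loop, `PIVOT` has a suitable value as soon as a suitable vertex has been checked. -/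
theorem wp_findPivot (h : Stores G r L S s) (hfits : Fits r B N)
    (hexists : ∃ v ∈ S.remaining, IsSimplicialIn G S.remaining v) :
    Wp B N findPivot
      (fun s' => ∃ v ∈ S.remaining, IsSimplicialIn G S.remaining v ∧ s' PIVOT 0 = v) s := by
  let Found (k : ℕ) (s' : Mem) : Prop :=
    (∃ v ∈ S.remaining, IsSimplicialIn G S.remaining v ∧ (v : ℕ) < k) →
      ∃ v ∈ S.remaining, IsSimplicialIn G S.remaining v ∧ s' PIVOT 0 = v
  refine wp_times (n := n) (by decide) (by simp [h.isInput.order]) hfits.order_le Found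
    (fun k s₁ s₂ heq => by simp only [Found, heq PIVOT (by decide), imp_self]) (by simp [Found])
    (fun k hk s₁ hs₁ hvertex hfound => ?_) fun s' _ hfound => ?_
  · refine wp_seq (((h.frame (by decide) hs₁).wp_checkVertex (v := ⟨k, hk⟩) hfits hvertex).mono
      fun s₂ hs₂ hblocked => wp_branch (fun hne => wp_skip ?_) fun h0 => ?_)
    · rintro ⟨v, hv, hsimplicial, hvk⟩
      rw [hs₂ PIVOT (by decide)]
      refine hfound ⟨v, hv, hsimplicial, (Nat.lt_succ_iff_lt_or_eq.1 hvk).resolve_right ?_⟩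
      rintro rfl
      exact hne (hblocked.2 ⟨hv, hsimplicial⟩)
    · have hvertex₂ : (cell VERTEX).eval s₂ = k :=
        (congrFun (hs₂ VERTEX (by decide)) 0).trans hvertex
      obtain ⟨hv, hsimplicial⟩ := hblocked.1 h0
      refine wp_write (hvertex₂ ▸ ?_) fun _ => ⟨⟨k, hk⟩, hv, hsimplicial, by simp [← hvertex₂]⟩
      exact hk.trans (hfits.order_le.trans_lt hfits.lt_two_pow)
  · obtain ⟨v, hv, hsimplicial⟩ := hexists
    exact hfound ⟨v, hv, hsimplicial, v.2⟩

end Stores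

end Pivot

/-! ### The elimination of a vertex -/

/-- A test whether `u` is a follower in the current round. -/
def follower (u : Expr) : Expr := adjacent (cell PIVOT) u * remaining u

/-- The value of `Round.radix` for the current round. -/
def radix (u : Expr) : Expr :=
  .ite (.ne u (cell PIVOT)) (.ite (follower u) (cell SCALE) 1) (cell SCALE)

/-- The value of `Round.lo` for the current round. -/
def lo (u : Expr) : Expr := .ite (follower u) (cell SCALE - cell GAP) 0

/-- The value of `Round.hi` for the current round. -/
def hi (u : Expr) : Expr :=
  .ite (.ne u (cell PIVOT)) (.ite (follower u) (cell SCALE) 1) (cell SCALE - cell GAP)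

/-- Appends the current round to the description of the strategy. -/
def pushRound : Prog :=
  times INDEX order (push DESCRIPTION (radix (cell INDEX))) >>
  times INDEX order (push DESCRIPTION (lo (cell INDEX))) >>
  times INDEX order (push DESCRIPTION (hi (cell INDEX)))

/-- Multiplies the numbers of colors and guesses by those of the current round. -/
def updateCounts : Prog :=
  times INDEX order (.write COLORS (cell INDEX)
    (.read COLORS (cell INDEX) * radix (cell INDEX))) >>
  times INDEX order (.write GUESSES (cell INDEX)
    (.read GUESSES (cell INDEX) * (hi (cell INDEX) - lo (cell INDEX))))

/-- Computes the weights of the next state. -/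
def updateWeights : Prog :=
  times INDEX order (.write WEIGHT (cell INDEX)
    (.ite (adjacent (cell PIVOT) (cell INDEX)) (.read WEIGHT (cell INDEX))
      (.read WEIGHT (cell INDEX) * cell GAP / cell SCALE)))

/-- Extends the strategy by the current round. -/
def appendRound : Prog := pushRound >> updateCounts

/-- Computes the next state apart from its weights. -/
def updateState : Prog :=
  .write FAILED 0 (.ite (cell GAP) (cell FAILED) 1) >>
  .write SCALE 0 (cell GAP + (1 - cell GAP)) >>
  .write ELIMINATED (cell PIVOT) 1

/-- Extends the strategy by the current round and computes the next state. -/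
def applyRound : Prog := appendRound >> updateWeights >> updateState

/-- Eliminates the vertex `PIVOT`. -/
def step : Prog :=
  .write GAP 0 (cell SCALE - .read WEIGHT (cell PIVOT)) >> applyRound

section Step

variable {n : ℕ} {G : SimpleGraph (Fin n)} {r : Fin n → ℚ≥0} {B N : ℕ} {s : Mem}
  {L : List (Round (Fin n))} {S S' : State (Fin n)} {ρ : Round (Fin n)} {v : Fin n}

/-- The current round is `ρ`. -/
structure StoresRound (ρ : Round (Fin n)) (s : Mem) : Prop where
  order : s INPUT 1 = n
  pivot : s PIVOT 0 = ρ.pivot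
  followers (u : Fin n) :
    s INPUT (2 + ρ.pivot * n + u) * (1 - s ELIMINATED u) = if u ∈ ρ.followers then 1 else 0
  modulus : s SCALE 0 = ρ.modulus
  gap : s GAP 0 + ρ.guess = ρ.modulus

namespace StoresRound

theorem frame {s' : Mem} {W : List ℕ} (h : StoresRound ρ s)
    (hW : ∀ A ∈ [INPUT, ELIMINATED, SCALE, GAP, PIVOT], A ∉ W)
    (hframe : ∀ A ∉ W, s' A = s A) : StoresRound ρ s' := by
  have heq (A : ℕ) (hA : A ∈ _) : s' A = s A := hframe A (hW A hA)
  simp only [List.forall_mem_cons] at heq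
  obtain ⟨hinput, heliminated, hscale, hgap, hpivot, -⟩ := heq
  exact ⟨hinput ▸ h.order, hpivot ▸ h.pivot, hinput ▸ heliminated ▸ h.followers,
    hscale ▸ h.modulus, hgap ▸ h.gap⟩

variable {e : Expr} {u : Fin n}

theorem guess_le (h : StoresRound ρ s) : ρ.guess ≤ ρ.modulus := by
  have := h.gap
  omega

theorem modulus_le_guess_iff (h : StoresRound ρ s) : ρ.modulus ≤ ρ.guess ↔ s GAP 0 = 0 := by
  have := h.gap
  omega

theorem gap_eq (h : StoresRound (S.round G v) s) : s GAP 0 = S.scale - S.weight v := by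
  have := h.gap
  simp only [State.round] at this
  omega

theorem eval_guess (h : StoresRound ρ s) : (cell SCALE - cell GAP).eval s = ρ.guess := by
  have := h.gap
  have := h.modulus
  simp only [Expr.eval_sub, Expr.eval_read, Expr.eval_ofNat]
  omega

theorem eval_follower (h : StoresRound ρ s) (hu : e.eval s = u) :
    (follower e).eval s = if u ∈ ρ.followers then 1 else 0 := by
  simp only [follower, adjacent, remaining, Expr.eval_mul, Expr.eval_read, Expr.eval_add,
    Expr.eval_sub, Expr.eval_ofNat, h.pivot, h.order, hu, h.followers]

theorem eval_radix (h : StoresRound ρ s) (hu : e.eval s = u) :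
    (radix e).eval s = ρ.radix u := by
  simp only [radix, Expr.eval_ite, Expr.eval_ne_eq_zero, h.eval_follower hu, Expr.eval_read,
    Expr.eval_ofNat, hu, h.pivot, h.modulus, Fin.val_inj, Round.radix]
  split_ifs <;> simp_all

theorem eval_lo (h : StoresRound ρ s) (hu : e.eval s = u) : (lo e).eval s = ρ.lo u := by
  simp only [lo, Expr.eval_ite, h.eval_follower hu, h.eval_guess, Expr.eval_ofNat, Round.lo]
  split_ifs <;> simp_all

theorem eval_hi (h : StoresRound ρ s) (hu : e.eval s = u) : (hi e).eval s = ρ.hi u := by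
  simp only [hi, Expr.eval_ite, Expr.eval_ne_eq_zero, h.eval_follower hu, Expr.eval_read,
    h.eval_guess, Expr.eval_ofNat, hu, h.pivot, h.modulus, Fin.val_inj, Round.hi]
  split_ifs <;> simp_all

theorem wp_pushRound (h : StoresRound ρ s) (hn : n ≤ N) (hmodulus : ρ.modulus < 2 ^ B)
    (hlength : (listAt s DESCRIPTION).length + 3 * n < 2 ^ B) :
    Wp B N pushRound (fun s' => listAt s' DESCRIPTION = listAt s DESCRIPTION ++
      (List.ofFn ρ.radix ++ List.ofFn ρ.lo ++ List.ofFn ρ.hi)) s := by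
  have hone (u : Fin n) : 1 < 2 ^ B := by
    have := u.pos
    omega
  have hguess := h.guess_le.trans_lt hmodulus
  refine wp_seq (wp_pushAll (n := n) (by simp) h.order hn ρ.radix (fun u => ?_) (by omega)
    (fun u s' hs' hindex => (h.frame (by decide) hs').eval_radix hindex) fun s₁ hs₁ h₁ => ?_)
  · rw [Round.radix]
    split_ifs
    exacts [hmodulus, hone u]
  have hρ₁ := h.frame (by decide) hs₁
  refine wp_seq (wp_pushAll (n := n) (by simp) hρ₁.order hn ρ.lo (fun u => ?_) ?_
    (fun u s' hs' hindex => (hρ₁.frame (by decide) hs').eval_lo hindex) fun s₂ hs₂ h₂ => ?_)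
  · rw [Round.lo]
    split_ifs
    exacts [hguess, (hone u).pos]
  · rw [h₁, List.length_append, List.length_ofFn]
    omega
  have hρ₂ := hρ₁.frame (by decide) hs₂
  refine wp_pushAll (n := n) (by simp) hρ₂.order hn ρ.hi (fun u => ?_) ?_
    (fun u s' hs' hindex => (hρ₂.frame (by decide) hs').eval_hi hindex) fun s₃ _ h₃ => ?_
  · rw [Round.hi]
    split_ifs
    exacts [hguess, hmodulus, hone u]
  · rw [h₂, h₁, List.length_append, List.length_append, List.length_ofFn, List.length_ofFn]
    omega
  · rw [h₃, h₂, h₁, List.append_assoc, List.append_assoc, List.append_assoc]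

theorem wp_updateCounts (h : StoresRound ρ s) (hn : n ≤ N)
    (hcolors : ∀ u : Fin n, s COLORS u * ρ.radix u < 2 ^ B)
    (hguesses : ∀ u : Fin n, s GUESSES u * ρ.bet u < 2 ^ B) :
    Wp B N updateCounts (fun s' => (∀ u : Fin n, s' COLORS u = s COLORS u * ρ.radix u) ∧
      ∀ u : Fin n, s' GUESSES u = s GUESSES u * ρ.bet u) s := by
  refine wp_seq (wp_fill (n := n) (by simp) h.order hn _ hcolors
    (fun u s' hs' hindex hcell => ?_) fun s₁ hs₁ h₁ => ?_)
  · simp only [Expr.eval_mul, Expr.eval_read, Expr.eval_ofNat, hindex, hcell,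
      (h.frame (by decide) hs').eval_radix (e := cell INDEX) hindex]
  have hρ₁ := h.frame (by decide) hs₁
  refine wp_fill (n := n) (by simp) hρ₁.order hn _ hguesses
    (fun u s' hs' hindex hcell => ?_) fun s₂ hs₂ h₂ => ⟨?_, h₂⟩
  · have hρ' := hρ₁.frame (by decide) hs'
    simp only [Expr.eval_mul, Expr.eval_sub, Expr.eval_read, Expr.eval_ofNat, hindex, hcell,
      hρ'.eval_lo (e := cell INDEX) hindex, hρ'.eval_hi (e := cell INDEX) hindex,
      hs₁ GUESSES (by decide), Round.bet]
  · rwa [hs₂ COLORS (by decide)]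

theorem wp_updateWeights (h : StoresRound (S.round G v) s) (hinput : IsInput G r (s INPUT))
    (hn : n ≤ N) (hweight : ∀ u : Fin n, s WEIGHT u = S.weight u)
    (hlt : ∀ u, (S.step G v).weight u < 2 ^ B) :
    Wp B N updateWeights (fun s' => ∀ u : Fin n, s' WEIGHT u = (S.step G v).weight u) s := by
  refine wp_fill (n := n) (by simp) h.order hn _ hlt (fun u s' hs' hindex hcell => ?_)
    fun s' _ hs' => hs'
  have hρ' := h.frame (by decide) hs'
  have hadjacent := (show IsInput G r (s' INPUT) from hs' INPUT (by decide) ▸ hinput).eval_adjacent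
    (e := cell PIVOT) (e' := cell INDEX) hρ'.pivot hindex
  simp only [Expr.eval_ite, hadjacent, Expr.eval_div, Expr.eval_mul, Expr.eval_read,
    Expr.eval_ofNat, hindex, hcell, hweight, hρ'.gap_eq, hρ'.modulus, State.round, State.step]
  split_ifs <;> simp_all

end StoresRound

theorem length_description (L : List (Round (Fin n))) :
    (description L).length = 3 * n * L.length := by
  simp only [description, List.length_flatMap, List.length_append, List.length_ofFn,
    List.map_const', List.sum_replicate, smul_eq_mul]
  ring

theorem description_append_singleton (L : List (Round (Fin n))) (ρ : Round (Fin n)) :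
    description (L ++ [ρ]) =
      description L ++ (List.ofFn ρ.radix ++ List.ofFn ρ.lo ++ List.ofFn ρ.hi) := by
  simp [description]

theorem Eliminates.length_le (he : Eliminates G r L S) : L.length ≤ n := by
  have := he.length_add_card_remaining
  rw [Fintype.card_fin] at this
  omega

theorem Eliminates.length_description_le (he : Eliminates G r L S) :
    (description L).length ≤ 3 * n ^ 2 := by
  rw [length_description, sq, ← mul_assoc]
  exact Nat.mul_le_mul_left _ he.length_le

theorem Eliminates.colors_lt (he : Eliminates G r L S) (hfits : Fits r B N) (u : Fin n) :
    colors L u < 2 ^ B :=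
  (he.colors_le u).trans_lt <| hfits.commonDen_pow_lt.trans_le' <|
    Nat.pow_le_pow_right (commonDen_pos r) (he.length_le.trans n.le_succ)

namespace Stores

theorem storesRound (h : Stores G r L S s) (hpivot : s PIVOT 0 = v)
    (hgap : s GAP 0 = S.scale - S.weight v) : StoresRound (S.round G v) s where
  order := h.isInput.order
  pivot := hpivot
  followers u := by
    rw [show (S.round G v).pivot = v from rfl, h.isInput.adj, h.eliminated]
    simp only [State.round, Finset.mem_filter]
    split_ifs <;> simp_all
  modulus := h.scale
  gap := by
    simp only [hgap, State.round]
    omega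

end Stores

theorem Stores.wp_appendRound (h : Stores G r L S s) (hρ : StoresRound ρ s)
    (he : Eliminates G r (L ++ [ρ]) S') (hfits : Fits r B N) :
    Wp B N appendRound (fun s' => (∀ u : Fin n, s' COLORS u = colors (L ++ [ρ]) u) ∧
      (∀ u : Fin n, s' GUESSES u = guesses (L ++ [ρ]) u) ∧
      listAt s' DESCRIPTION = description (L ++ [ρ])) s := by
  have hmodulus : ρ.modulus < 2 ^ B := (he.modulus_le (by simp)).trans_lt hfits.commonDen_lt
  refine wp_seq ((hρ.wp_pushRound hfits.order_le hmodulus ?_).mono fun s₁ hs₁ h₁ => ?_)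
  · have := he.length_description_le
    have := hfits.length_le
    have := hfits.lt_two_pow
    rw [description_append_singleton] at *
    simp only [List.length_append, List.length_ofFn] at *
    rw [h.listAt_description]
    omega
  have hcolors (u : Fin n) : s₁ COLORS u * ρ.radix u = colors (L ++ [ρ]) u := by
    rw [hs₁ COLORS (by decide), h.colors_eq, colors_append_singleton]
  have hguesses (u : Fin n) : s₁ GUESSES u * ρ.bet u = guesses (L ++ [ρ]) u := by
    rw [hs₁ GUESSES (by decide), h.guesses_eq, guesses_append_singleton]
  refine ((hρ.frame (by decide) hs₁).wp_updateCounts hfits.order_le (fun u => ?_) fun u => ?_).mono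
    fun s₂ hs₂ h₂ => ?_
  · exact hcolors u ▸ he.colors_lt hfits u
  · exact hguesses u ▸ (he.isLegal.guesses_le_colors u).trans_lt (he.colors_lt hfits u)
  · simp only [hcolors, hguesses] at h₂
    refine ⟨h₂.1, h₂.2, ?_⟩
    rw [listAt_congr (hs₂ DESCRIPTION (by decide)), h₁, h.listAt_description,
      description_append_singleton]

theorem wp_updateState (hB : 1 < 2 ^ B) :
    Wp B N updateState (fun s' => s' FAILED 0 = (if s GAP 0 = 0 then 1 else s FAILED 0) ∧
      s' SCALE 0 = max (s GAP 0) 1 ∧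
      s' ELIMINATED = Function.update (s ELIMINATED) (s PIVOT 0) 1) s := by
  intro hN hs
  have hgap := hs GAP 0
  refine wp_seq (wp_write ?_ (wp_seq (wp_write ?_ (wp_write ?_ ⟨?_, ?_, ?_⟩)))) hN hs
  · rw [Expr.eval_ite]
    split_ifs
    exacts [hB, hs FAILED 0]
  · simp only [Expr.eval_add, Expr.eval_sub, Expr.eval_read, Expr.eval_ofNat, Mem.set_of_ne, ne_eq,
      Nat.reduceEqDiff, not_false_eq_true]
    omega
  · exact hB
  · simp
    rfl
  · simp
    omega
  · simp

theorem Stores.wp_applyRound (h : Stores G r L S s) (hround : StoresRound (S.round G v) s)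
    (he : Eliminates G r (L ++ [S.round G v]) (S.step G v)) (hfits : Fits r B N) :
    Wp B N applyRound (Stores G r (L ++ [S.round G v]) (S.step G v)) s := by
  refine wp_seq ((h.wp_appendRound hround he hfits).mono
    fun s₁ hs₁ ⟨hcolors, hguesses, hdescription⟩ => ?_)
  refine wp_seq (((hround.frame (by decide) hs₁).wp_updateWeights
    (hs₁ INPUT (by decide) ▸ h.isInput) hfits.order_le
    (by rw [hs₁ WEIGHT (by decide)]; exact h.weight) fun u => ?_).mono fun s₂ hs₂ hweight => ?_)
  · exact (he.weight_le u).trans_lt (hfits.num_mul_commonDen_lt u)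
  refine (wp_updateState hfits.one_lt).mono fun s₃ hs₃ ⟨hfailed, hscale, heliminated⟩ => ?_
  have hunchanged {A : ℕ} (hA : A ∉ [DESCRIPTION, COLORS, GUESSES, WEIGHT, INDEX]) :
      s₂ A = s A := by
    simp only [List.mem_cons, List.not_mem_nil, or_false, not_or] at hA
    rw [hs₂ A (by simp [updateWeights, times, writes_andThen, writes, hA]), hs₁ A (by
      simp [appendRound, pushRound, push, updateCounts, times, writes_andThen, writes, hA])]
  rw [hunchanged (A := GAP) (by decide)] at hfailed hscale
  rw [hunchanged (A := FAILED) (by decide)] at hfailed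
  exact {
    isInput := by
      rw [hs₃ INPUT (by decide), hunchanged (by decide)]
      exact h.isInput
    scale := by rw [hscale, hround.gap_eq]; rfl
    weight u := by rw [hs₃ WEIGHT (by decide), hweight]
    eliminated u := by
      rw [heliminated, hunchanged (by decide), hunchanged (by decide), hround.pivot,
        Function.update_apply, h.eliminated]
      simp only [State.round, State.step, Finset.mem_erase, Fin.val_inj]
      split_ifs <;> simp_all
    colors_eq u := by rw [hs₃ COLORS (by decide), hs₂ COLORS (by decide), hcolors]
    guesses_eq u := by rw [hs₃ GUESSES (by decide), hs₂ GUESSES (by decide), hguesses]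
    failed := by
      simp only [List.mem_append, List.mem_singleton, or_and_right, exists_or, exists_eq_left,
        ← h.failed, hround.modulus_le_guess_iff, hfailed]
      split_ifs <;> simp_all
    listAt_description := by
      rw [listAt_congr (hs₃ DESCRIPTION (by decide)), listAt_congr (hs₂ DESCRIPTION (by decide)),
        hdescription] }

theorem Stores.wp_step (h : Stores G r L S s) (he : Eliminates G r L S) (hfits : Fits r B N)
    (hv : v ∈ S.remaining) (hs : IsSimplicialIn G S.remaining v) (hpivot : s PIVOT 0 = v) :
    Wp B N step (Stores G r (L ++ [S.round G v]) (S.step G v)) s := by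
  have hscale := he.scale_le.trans_lt hfits.commonDen_lt
  have hgap : (cell SCALE - .read WEIGHT (cell PIVOT)).eval s = S.scale - S.weight v := by
    simp only [Expr.eval_sub, Expr.eval_read, Expr.eval_ofNat, hpivot, h.scale, h.weight]
  refine wp_seq ((wp_write (Q := fun s' => s' GAP 0 = S.scale - S.weight v)
    (by rw [hgap]; omega) (by simp [← hgap])).mono fun s₁ hs₁ h₁ => ?_)
  have h' := h.frame (by decide) hs₁
  exact h'.wp_applyRound (h'.storesRound ((congrFun (hs₁ PIVOT (by decide)) 0).trans hpivot) h₁)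
    (he.step hv hs) hfits

end Step

/-! ### The decision program -/

/-- Writes the strategy to the output. -/
def pushStrategy : Prog :=
  times INDEX order (push OUTPUT (.read COLORS (cell INDEX))) >>
  times INDEX order (push OUTPUT (.read GUESSES (cell INDEX))) >>
  times INDEX (cell DESCRIPTION) (push OUTPUT (.read DESCRIPTION (cell INDEX + 1)))

/-- Writes the output: `0` and the strategy if there is one, and `1` otherwise. -/
def report : Prog :=
  .branch (cell FAILED) (push OUTPUT 0 >> pushStrategy) (push OUTPUT 1)

/-- Decides whether `r` belongs to the region, and finds a winning strategy if it does not. -/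
def decisionProg : Prog :=
  prepare >> times ROUND order (findPivot >> step) >> report

section Output

variable {n : ℕ} {G : SimpleGraph (Fin n)} {r : Fin n → ℚ≥0} {B N : ℕ} {s : Mem}
  {L : List (Round (Fin n))} {S : State (Fin n)}

open Classical in
/-- The output of the decision program in the case that its elimination has the rounds `L`. -/
noncomputable def result (L : List (Round (Fin n))) : List ℕ :=
  if ∃ ρ ∈ L, ρ.modulus ≤ ρ.guess then
    0 :: (List.ofFn (colors L) ++ List.ofFn (guesses L) ++ description L)
  else [1]

theorem ofFn_eq_listAt (s : Mem) (A : ℕ) :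
    (List.ofFn fun k : Fin (s A 0) => s A (k + 1)) = listAt s A := by
  rw [listAt, List.ofFn_eq_map, ← List.map_coe_finRange_eq_range, List.map_map]
  rfl

theorem Stores.wp_pushStrategy (h : Stores G r L S s) (he : Eliminates G r L S)
    (hfits : Fits r B N) (houtput : listAt s OUTPUT = [0]) :
    Wp B N pushStrategy (fun s' => listAt s' OUTPUT =
      0 :: (List.ofFn (colors L) ++ List.ofFn (guesses L) ++ description L)) s := by
  intro hN hs
  have hfit := hfits.length_le
  have hlength : s DESCRIPTION 0 ≤ 3 * n ^ 2 := by
    rw [← length_listAt s DESCRIPTION, h.listAt_description]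
    exact he.length_description_le
  have hcolors := he.colors_lt hfits
  have hguesses (u : Fin n) := (he.isLegal.guesses_le_colors u).trans_lt (hcolors u)
  refine wp_seq (wp_pushAll (n := n) (by simp) h.isInput.order hfits.order_le _ hcolors ?_
    (fun u s' hs' hindex => ?_) fun s₁ hs₁ h₁ => ?_) hN hs
  · rw [houtput, List.length_singleton]
    omega
  · simp only [Expr.eval_read, Expr.eval_ofNat, hindex, hs' COLORS (by decide), h.colors_eq]
  have hStores := h.frame (by decide) hs₁
  refine wp_seq (wp_pushAll (n := n) (by simp) hStores.isInput.order hfits.order_le _ hguesses ?_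
    (fun u s' hs' hindex => ?_) fun s₂ hs₂ h₂ => ?_)
  · rw [h₁, houtput, List.length_append, List.length_singleton, List.length_ofFn]
    omega
  · simp only [Expr.eval_read, Expr.eval_ofNat, hindex, hs' GUESSES (by decide),
      hStores.guesses_eq]
  have hdescription : s₂ DESCRIPTION = s DESCRIPTION := by
    rw [hs₂ DESCRIPTION (by decide), hs₁ DESCRIPTION (by decide)]
  refine wp_pushAll (n := s DESCRIPTION 0) (by simp) (by simp [hdescription])
    (by omega) (fun k => s DESCRIPTION (k + 1)) (fun k => hs _ _) ?_
    (fun k s' hs' hindex => ?_) fun s₃ _ h₃ => ?_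
  · rw [h₂, h₁, houtput, List.length_append, List.length_append, List.length_singleton,
      List.length_ofFn, List.length_ofFn]
    omega
  · simp only [Expr.eval_read, Expr.eval_add, Expr.eval_ofNat, hindex, hs' DESCRIPTION (by decide),
      hdescription]
  · rw [h₃, h₂, h₁, houtput, ofFn_eq_listAt, h.listAt_description]
    simp only [List.append_assoc, List.cons_append, List.nil_append]

theorem Stores.wp_report (h : Stores G r L S s) (he : Eliminates G r L S) (hfits : Fits r B N)
    (houtput : listAt s OUTPUT = []) : Wp B N report (fun s' => output s' = result L) s := by
  change Wp B N report (fun s' => listAt s' OUTPUT = result L) s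
  refine wp_branch (fun hfailed => wp_seq (wp_push hfits.one_lt.pos ?_ fun s₁ hs₁ h₁ => ?_))
    fun hfailed => wp_push hfits.one_lt ?_ fun s₁ _ h₁ => ?_
  · simpa [houtput] using hfits.one_lt
  · have hprefix : listAt s₁ OUTPUT = [0] := by rw [h₁, houtput]; rfl
    have h' := h.frame (W := [OUTPUT]) (by decide) (by simpa using hs₁)
    exact (h'.wp_pushStrategy he hfits hprefix).mono fun s₂ _ h₂ => by
      rw [h₂, result, if_pos (h.failed.1 hfailed)]
  · simpa [houtput] using hfits.one_lt
  · rw [h₁, houtput, result, if_neg (h.failed.not.1 (not_not.2 hfailed))]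
    rfl

theorem wp_decisionProg (hG : IsChordal G) (hfits : Fits r B N) (h : IsInput G r (s INPUT))
    (hs : ∀ A ≠ INPUT, ∀ i, s A i = 0) :
    Wp B N decisionProg (fun s' => ∃ L S, Eliminates G r L S ∧ S.remaining = ∅ ∧
      output s' = result L) s := by
  refine wp_seq ((wp_prepare hfits h hs).mono fun s₁ hs₁ h₁ => ?_)
  let I (k : ℕ) (s' : Mem) : Prop := ∃ L S, Eliminates G r L S ∧ L.length = k ∧ Stores G r L S s'
  refine wp_seq (wp_times (n := n) (by decide) h₁.isInput.order hfits.order_le I ?_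
    ⟨[], _, .init, rfl, h₁⟩ ?_ ?_)
  · rintro k s s' heq ⟨L, S, he, hL, hS⟩
    exact ⟨L, S, he, hL, hS.frame (W := [ROUND]) (by decide) (by simpa using heq)⟩
  · rintro k hk s₂ - - ⟨L, S, he, rfl, hS⟩
    have hcard := he.length_add_card_remaining
    rw [Fintype.card_fin] at hcard
    refine wp_seq ((hS.wp_findPivot hfits (hG.exists_simplicial (Finset.card_pos.1
      (by omega)))).mono fun s₃ hs₃ ⟨v, hv, hsimplicial, hpivot⟩ => ?_)
    refine ((hS.frame (by decide) hs₃).wp_step he hfits hv hsimplicial hpivot).mono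
      fun s₄ _ h₄ => ⟨_, _, he.step hv hsimplicial, by simp, h₄⟩
  · rintro s₂ hs₂ ⟨L, S, he, hL, hS⟩
    have hcard := he.length_add_card_remaining
    rw [Fintype.card_fin, hL, Nat.add_eq_left, Finset.card_eq_zero] at hcard
    have houtput : listAt s₂ OUTPUT = [] := by
      rw [listAt, hs₂ OUTPUT (by decide), hs₁ OUTPUT (by decide), hs OUTPUT (by decide)]
      rfl
    exact (hS.wp_report he hfits houtput).mono fun s₃ _ h₃ => ⟨L, S, he, hcard, h₃⟩

end Output

/-! ### The evaluation of a strategy -/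

local notation "REST" => (2 : ℕ)
local notation "SUM" => (3 : ℕ)
local notation "LOST" => (4 : ℕ)

/-- The `radix` of a vertex in the current round. -/
def radixEntry (u : Expr) : Expr := .read INPUT (4 + order + (3 * order * cell ROUND + u))

/-- The least residue on which a vertex bets in the current round. -/
def loEntry (u : Expr) : Expr := .read INPUT (4 + order + (3 * order * cell ROUND + (order + u)))

/-- The upper bound of the residues on which a vertex bets in the current round. -/
def hiEntry (u : Expr) : Expr :=
  .read INPUT (4 + order + (3 * order * cell ROUND + (2 * order + u)))

/-- The vertex whose guess is to be decided. -/
def queried : Expr := .read INPUT 2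

/-- The residue of the sum of the last digits. -/
def residue : Expr := cell SUM % radixEntry queried

/-- Adds up the last digits of the colors that are left. -/
def addDigits : Prog :=
  .write SUM 0 0 >>
  times INDEX order
    (.write SUM 0 (cell SUM + .read REST (cell INDEX) % radixEntry (cell INDEX)))

/-- Plays the current round with the colors that are left. -/
def playRound : Prog :=
  addDigits >>
  .write LOST 0
    (.ite (loEntry queried - residue + (residue + 1 - hiEntry queried)) 1 (cell LOST)) >>
  times INDEX order
    (.write REST (cell INDEX) (.read REST (cell INDEX) / radixEntry (cell INDEX)))

/-- Decides whether a vertex guesses a color. -/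
def evaluationProg : Prog :=
  times INDEX order (.write REST (cell INDEX) (.read INPUT (4 + cell INDEX))) >>
  .write REST queried (.read INPUT 3) >>
  times ROUND order playRound >>
  push OUTPUT (1 - cell LOST)

section Evaluation

variable {n : ℕ} {L : List (Round (Fin n))} {v : Fin n} {a : ℕ} {c d : Fin n → ℕ} {B N : ℕ}
  {s : Mem}

/-- The array `x` holds the description of the strategy with rounds `L`, a vertex `v`, a color `a`
and the colors `c` seen from `v`. -/
structure IsQuery (L : List (Round (Fin n))) (v : Fin n) (a : ℕ) (c : Fin n → ℕ) (x : ℕ → ℕ) :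
    Prop where
  order : x 1 = n
  vertex : x 2 = v
  color : x 3 = a
  seen (u : Fin n) : x (4 + u) = c u
  radix {k : ℕ} (hk : k < L.length) (u : Fin n) : x (4 + n + (3 * n * k + u)) = L[k].radix u
  lo {k : ℕ} (hk : k < L.length) (u : Fin n) : x (4 + n + (3 * n * k + (n + u))) = L[k].lo u
  hi {k : ℕ} (hk : k < L.length) (u : Fin n) :
    x (4 + n + (3 * n * k + (2 * n + u))) = L[k].hi u

namespace IsQuery

variable {k : ℕ} {e : Expr} {u : Fin n}

theorem eval_radixEntry (h : IsQuery L v a c (s INPUT)) (hk : k < L.length) (hround : s ROUND 0 = k)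
    (hu : e.eval s = u) : (radixEntry e).eval s = L[k].radix u := by
  simp only [radixEntry, Expr.eval_read, Expr.eval_add, Expr.eval_mul, Expr.eval_ofNat, hu,
    h.order, hround, h.radix hk]

theorem eval_loEntry (h : IsQuery L v a c (s INPUT)) (hk : k < L.length) (hround : s ROUND 0 = k)
    (hu : e.eval s = u) : (loEntry e).eval s = L[k].lo u := by
  simp only [loEntry, Expr.eval_read, Expr.eval_add, Expr.eval_mul, Expr.eval_ofNat, hu,
    h.order, hround, h.lo hk]

theorem eval_hiEntry (h : IsQuery L v a c (s INPUT)) (hk : k < L.length) (hround : s ROUND 0 = k)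
    (hu : e.eval s = u) : (hiEntry e).eval s = L[k].hi u := by
  simp only [hiEntry, Expr.eval_read, Expr.eval_add, Expr.eval_mul, Expr.eval_ofNat, hu,
    h.order, hround, h.hi hk]

theorem wp_addDigits (h : IsQuery L v a c (s INPUT)) (hn : n ≤ N) (hk : k < L.length)
    (hround : s ROUND 0 = k) (hrest : ∀ u : Fin n, s REST u = d u) (hsum : ∑ u, d u < 2 ^ B) :
    Wp B N addDigits (fun s' => s' SUM 0 = ∑ u, d u % L[k].radix u) s := by
  let F (j : ℕ) : ℕ := ∑ i ∈ Finset.range j, s REST i % s INPUT (4 + n + (3 * n * k + i))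
  have hF : F n = ∑ u, d u % L[k].radix u := by
    simp only [F, Finset.sum_range, hrest, h.radix hk]
  refine wp_seq (wp_write (by simp) (wp_fold (n := n) (by simp) (by simp [h.order]) hn F
    (by simp [F]) (fun j hj => ?_) (fun j _ s' hs' hindex hacc => ?_)
    fun s' _ hsum' => hsum'.trans hF))
  · calc F j ≤ F n := Finset.sum_le_sum_of_subset (Finset.range_subset_range.2 hj)
      _ = ∑ u, d u % L[k].radix u := hF
      _ ≤ ∑ u, d u := Finset.sum_le_sum fun u _ => Nat.mod_le _ _
      _ < 2 ^ B := hsum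
  · have heq {A : ℕ} (hA : A ∉ [INDEX, SUM]) : s' A = s A := by
      rw [hs' A hA, Mem.set_of_ne _ _ _ fun h => hA (by simp [h])]
    simp only [radixEntry, Expr.eval_add, Expr.eval_mod, Expr.eval_mul, Expr.eval_read,
      Expr.eval_ofNat, hacc, hindex, heq (A := REST) (by decide), heq (A := INPUT) (by decide),
      heq (A := ROUND) (by decide), h.order, hround]
    exact (Finset.sum_range_succ ..).symm

theorem wp_playRound (h : IsQuery L v a c (s INPUT)) (hn : n ≤ N) (hk : k < L.length)
    (hround : s ROUND 0 = k) (hrest : ∀ u : Fin n, s REST u = d u) (hsum : ∑ u, d u < 2 ^ B) :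
    Wp B N playRound (fun s' => (∀ u : Fin n, s' REST u = L[k].quotient d u) ∧
      (s' LOST 0 = 0 ↔ s LOST 0 = 0 ∧ L[k].Passes d v)) s := by
  intro hN hs
  have hvertex {s' : Mem} (hinput : s' INPUT = s INPUT) : queried.eval s' = v := by
    rw [queried, Expr.eval_read, Expr.eval_ofNat, hinput, h.vertex]
  refine wp_seq ((h.wp_addDigits hn hk hround hrest hsum).mono fun s₁ hs₁ hsum₁ => ?_) hN hs
  have hinput₁ : s₁ INPUT = s INPUT := hs₁ INPUT (by decide)
  have hround₁ : s₁ ROUND 0 = k := by rw [hs₁ ROUND (by decide), hround]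
  have h₁ : IsQuery L v a c (s₁ INPUT) := hinput₁ ▸ h
  have hv := hvertex hinput₁
  refine wp_seq ((wp_write (Q := fun s₂ => s₂ LOST 0 = 0 ↔ s LOST 0 = 0 ∧ L[k].Passes d v)
    ?_ ?_).mono fun s₂ hs₂ hlost => ?_)
  · rw [Expr.eval_ite]
    split_ifs
    · simpa [hs₁ LOST (by decide)] using hs LOST 0
    · have := v.pos
      simp only [Expr.eval_ofNat]
      omega
  · simp only [Mem.set_self, Expr.eval_ofNat, Function.update_self, Expr.eval_ite, Expr.eval_add,
      Expr.eval_sub, residue, Expr.eval_mod, h₁.eval_loEntry hk hround₁ hv,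
      h₁.eval_hiEntry hk hround₁ hv, h₁.eval_radixEntry hk hround₁ hv, Expr.eval_read, hsum₁,
      hs₁ LOST (by decide), Round.Passes, Set.mem_Ico]
    split_ifs
    · omega
    · exact iff_of_false id (by omega)
  have hrest₂ (u : Fin n) : s₂ REST u = d u := by
    rw [hs₂ REST (by decide), hs₁ REST (by decide), hrest]
  have hinput₂ : s₂ INPUT = s INPUT := (hs₂ INPUT (by decide)).trans hinput₁
  refine wp_fill (n := n) (by simp) (by simp [hinput₂, h.order]) hn (L[k].quotient d)
    (fun u => ?_) (fun u s' hs' hindex hcell => ?_)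
    fun s₃ hs₃ hquotient => ⟨hquotient, by rw [hs₃ LOST (by decide), hlost]⟩
  · exact (Nat.div_le_self _ _).trans_lt (hrest u ▸ hs REST u)
  · have hradix := IsQuery.eval_radixEntry (s := s') (e := cell INDEX) (u := u)
      (by rw [hs' INPUT (by decide), hinput₂]; exact h) hk
      (by rw [hs' ROUND (by decide), hs₂ ROUND (by decide), hround₁]) hindex
    simp only [Expr.eval_div, hradix, Expr.eval_read, Expr.eval_ofNat, hindex, hcell, hrest₂,
      Round.quotient]

open Classical in
theorem wp_evaluationProg (h : IsQuery L v a c (s INPUT)) (hn : n ≤ N) (hL : L.length = n)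
    (hsum : ∑ u, Function.update c v a u < 2 ^ B) (hs₀ : ∀ A ≠ INPUT, ∀ i, s A i = 0) :
    Wp B N evaluationProg
      (fun s' => output s' = [if Guesses L (Function.update c v a) v then 1 else 0]) s := by
  intro hN hs
  have hone : 1 < 2 ^ B := by have := v.pos; omega
  refine wp_seq (wp_fill (n := n) (by simp) h.order hn c (fun u => h.seen u ▸ hs INPUT _)
    (fun u s' hs' hindex _ => ?_) fun s₁ hs₁ hseen => ?_) hN hs
  · simp only [Expr.eval_read, Expr.eval_add, Expr.eval_ofNat, hindex, hs' INPUT (by decide),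
      h.seen]
  have hinput₁ : s₁ INPUT = s INPUT := hs₁ INPUT (by decide)
  refine wp_seq ((wp_write (Q := fun s₂ => ∀ u : Fin n, s₂ REST u = Function.update c v a u)
    ?_ fun u => ?_).mono fun s₂ hs₂ hrest => ?_)
  · simpa [hinput₁] using hs INPUT 3
  · simp [queried, hinput₁, h.vertex, h.color, Function.update_apply, hseen, Fin.ext_iff]
  have hinput₂ : s₂ INPUT = s INPUT := (hs₂ INPUT (by decide)).trans hinput₁
  let I (k : ℕ) (s' : Mem) : Prop := ∃ d, (∀ u : Fin n, s' REST u = d u) ∧ ∑ u, d u < 2 ^ B ∧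
    (Guesses L (Function.update c v a) v ↔ s' LOST 0 = 0 ∧ Guesses (L.drop k) d v)
  refine wp_seq (wp_times (n := n) (by decide) (by simp [hinput₂, h.order]) hn I ?_
    ⟨_, hrest, hsum, ?_⟩ ?_ ?_)
  · rintro k s s' heq ⟨d, hd, hd', hguess⟩
    exact ⟨d, by rwa [heq REST (by decide)], hd', by rwa [heq LOST (by decide)]⟩
  · rw [hs₂ LOST (by decide), hs₁ LOST (by decide), hs₀ LOST (by decide), List.drop_zero]
    simp only [true_and]
  · rintro k hk s₃ hs₃ hround ⟨d, hd, hd', hguess⟩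
    rw [← hL] at hk
    have h₃ : IsQuery L v a c (s₃ INPUT) := by rwa [hs₃ INPUT (by decide), hinput₂]
    refine (h₃.wp_playRound hn hk hround hd hd').mono fun s₄ _ ⟨hquotient, hlost⟩ => ⟨_, hquotient,
      (Finset.sum_le_sum fun u _ => Nat.div_le_self _ _).trans_lt hd', ?_⟩
    rw [hguess, hlost, List.drop_eq_getElem_cons hk, Guesses, and_assoc]
  · rintro s₃ hs₃ ⟨d, -, -, hguess⟩
    have houtput : listAt s₃ OUTPUT = [] := by
      rw [listAt, hs₃ OUTPUT (by decide), hs₂ OUTPUT (by decide), hs₁ OUTPUT (by decide),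
        hs₀ OUTPUT (by decide)]
      rfl
    refine wp_push ((Nat.sub_le _ _).trans_lt hone) (by simpa [houtput] using hone)
      fun s₄ _ h₄ => ?_
    change listAt s₄ OUTPUT = _
    rw [h₄, houtput, List.nil_append, hguess, List.drop_of_length_le hL.le, Guesses, and_true]
    simp only [Expr.eval_sub, Expr.eval_ofNat, Expr.eval_read]
    split_ifs <;> simp <;> omega

end IsQuery

end Evaluation

/-! ### Inputs and outputs -/

theorem getElem?_flatMap_of_length_eq {α β : Type*} {f : α → List β} {m j : ℕ}
    (hf : ∀ a, (f a).length = m) (hj : j < m) :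
    ∀ {l : List α} {k : ℕ} (hk : k < l.length), (l.flatMap f)[m * k + j]? = (f l[k])[j]?
  | a :: l, 0, _ => by
    rw [List.flatMap_cons, mul_zero, zero_add, List.getElem?_append_left (by rwa [hf])]
    rfl
  | a :: l, k + 1, hk => by
    rw [List.flatMap_cons, List.getElem?_append_right (by rw [hf]; nlinarith), hf,
      show m * (k + 1) + j - m = m * k + j by rw [mul_add_one]; omega,
      getElem?_flatMap_of_length_eq hf hj (Nat.lt_of_succ_lt_succ hk)]
    rfl

theorem length_le_bitSize (x : List ℕ) : x.length ≤ bitSize x := by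
  simp [bitSize]

theorem lt_two_pow_bitSize {x : List ℕ} {k : ℕ} (hk : k ∈ x) : k < 2 ^ bitSize x :=
  Nat.size_le.1 <| (Nat.le_succ _).trans <| List.single_le_sum (by simp) _ <|
    List.mem_map_of_mem (f := fun k : ℕ => k.size + 1) hk

theorem bitSize_le {x : List ℕ} {B : ℕ} (h : ∀ k ∈ x, k < 2 ^ B) :
    bitSize x ≤ x.length * (B + 1) := by
  have hle : ∀ l ∈ x.map fun k => k.size + 1, l ≤ B + 1 := by
    simpa only [List.forall_mem_map, add_le_add_iff_right, Nat.size_le] using h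
  simpa [bitSize] using List.sum_le_card_nsmul _ _ hle

theorem initMem_input (x : List ℕ) (i : ℕ) : initMem x INPUT (i + 1) = x[i]?.getD 0 := by
  simp [initMem]

theorem initMem_of_ne (x : List ℕ) {A : ℕ} (hA : A ≠ INPUT) (i : ℕ) : initMem x A i = 0 :=
  if_neg hA

theorem initMem_bounded {x : List ℕ} {B : ℕ} (hB : bitSize x ≤ B) : (initMem x).Bounded B := by
  intro A i
  refine lt_of_lt_of_le ?_ (Nat.pow_le_pow_right two_pos hB)
  by_cases hA : A = INPUT
  · subst hA
    cases i with
    | zero => exact (length_le_bitSize x).trans_lt Nat.lt_two_pow_self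
    | succ i =>
      rw [initMem_input]
      rcases lt_or_ge i x.length with hi | hi
      · simpa [hi] using lt_two_pow_bitSize (List.getElem_mem hi)
      · simp [hi]
  · rw [initMem_of_ne x hA]
    positivity

theorem Mem.Bounded.bitSize_output_le {s : Mem} {B : ℕ} (hs : s.Bounded B) :
    bitSize (output s) ≤ (output s).length * (B + 1) :=
  bitSize_le (List.forall_mem_map.2 fun i _ => hs OUTPUT (i + 1))

theorem Wp.outputsWithin {p : Prog} {x : List ℕ} {B N : ℕ} {Q : Mem → Prop}
    (h : Wp B N p Q (initMem x)) (hN : N < 2 ^ B) (hx : bitSize x ≤ B) :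
    ∃ s, Q s ∧ s.Bounded B ∧ OutputsWithin p x (p.timeBound.eval N * (B + 1) ^ 2) (output s) := by
  obtain ⟨t, s, hruns, ht, hs, hQ⟩ := h hN (initMem_bounded hx)
  exact ⟨s, hQ, hs, t, s, hruns, ht, rfl⟩

open Polynomial in
/-- A bound for the number of iterations of a loop of the decision program, in terms of the length
of the input. -/
noncomputable def loopBound : ℕ[X] := 3 * X ^ 2 + 2 * X + 1

open Polynomial in
/-- A bound for the lengths of the numbers that occur in the decision program, in terms of the
length of the input. -/
noncomputable def wordLength : ℕ[X] := X ^ 3 + X ^ 2 + loopBound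

open Polynomial in
/-- A bound for the running time of the decision program, in terms of the length of the input. -/
noncomputable def decisionTime : ℕ[X] :=
  decisionProg.timeBound.comp loopBound * (wordLength + 1) ^ 2

open Polynomial in
/-- A bound for the running time of the evaluation program, in terms of the length of the query. -/
noncomputable def evaluationTime : ℕ[X] := evaluationProg.timeBound * (2 * X + 2) ^ 2

theorem Eliminates.length_result_le {n : ℕ} {G : SimpleGraph (Fin n)} {r : Fin n → ℚ≥0}
    {L : List (Round (Fin n))} {S : State (Fin n)} (h : Eliminates G r L S) :
    (result L).length ≤ 3 * n ^ 2 + 2 * n + 1 := by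
  have := h.length_description_le
  rw [result]
  split_ifs
  · simp only [List.length_cons, List.length_append, List.length_ofFn]
    omega
  · simp

section Input

variable {n : ℕ} (G : SimpleGraph (Fin n)) (r : Fin n → ℚ≥0)

theorem le_bitSize_encodeInput : n ≤ bitSize (encodeInput G r) := by
  refine le_trans ?_ (length_le_bitSize _)
  simp [encodeInput]
  omega

theorem isInput_encodeInput : IsInput G r (initMem (encodeInput G r) INPUT) := by
  classical
  let row (u : Fin n) : List ℕ := List.ofFn fun v => if G.Adj u v then 1 else 0
  let num : List ℕ := List.ofFn fun v => (r v).num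
  let den : List ℕ := List.ofFn fun v => (r v).den
  have hrow (u : Fin n) : (row u).length = n := List.length_ofFn
  have hmatrix : ((List.finRange n).flatMap row).length = n * n := by
    simp [List.length_flatMap, hrow]
  have hlt (u v : Fin n) : n * u + v < n * n := by
    calc n * u + v < n * (u + 1) := by rw [mul_add_one]; omega
      _ ≤ n * n := Nat.mul_le_mul_left _ u.2
  have hread (k : ℕ) : initMem (encodeInput G r) INPUT (2 + k) =
      ((List.finRange n).flatMap row ++ (num ++ den))[k]?.getD 0 := by
    rw [← List.append_assoc, add_comm 2, initMem_input]
    simp only [encodeInput, List.cons_append, List.getElem?_cons_succ]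
    rfl
  refine ⟨initMem_input _ 0, fun u v => ?_, fun u => ?_, fun u => ?_⟩
  · rw [add_assoc, mul_comm, hread, List.getElem?_append_left (by rw [hmatrix]; exact hlt u v),
      getElem?_flatMap_of_length_eq hrow v.2 (by simp)]
    simp [row]
  · rw [add_assoc, hread, List.getElem?_append_right (by omega), hmatrix, Nat.add_sub_cancel_left,
      List.getElem?_append_left (by simp [num])]
    simp [num]
  · rw [add_assoc, add_assoc, hread, List.getElem?_append_right (by omega), hmatrix,
      Nat.add_sub_cancel_left, List.getElem?_append_right (by simp [num])]
    simp [num, den]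

theorem fits_encodeInput : Fits r (wordLength.eval (bitSize (encodeInput G r)))
    (loopBound.eval (bitSize (encodeInput G r))) := by
  have hn := le_bitSize_encodeInput G r
  have hden (u : Fin n) : (r u).den < 2 ^ bitSize (encodeInput G r) :=
    lt_two_pow_bitSize (by simp [encodeInput])
  have hnum (u : Fin n) : (r u).num < 2 ^ bitSize (encodeInput G r) :=
    lt_two_pow_bitSize (by simp [encodeInput])
  simp only [wordLength, loopBound, Polynomial.eval_add, Polynomial.eval_mul, Polynomial.eval_pow,
    Polynomial.eval_X, Polynomial.eval_ofNat, Polynomial.eval_one]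
  generalize bitSize (encodeInput G r) = b at *
  have hcommonDen : commonDen r ≤ 2 ^ b ^ 2 := by
    calc commonDen r ≤ ∏ _u : Fin n, 2 ^ b := Finset.prod_le_prod' fun u _ => (hden u).le
      _ = 2 ^ (b * n) := by rw [Finset.prod_const, Finset.card_fin, pow_mul]
      _ ≤ 2 ^ b ^ 2 := Nat.pow_le_pow_right two_pos (by rw [sq]; gcongr)
  refine ⟨by gcongr, ?_, ?_, fun u => ?_⟩
  · exact Nat.lt_two_pow_self.trans_le (Nat.pow_le_pow_right two_pos (by omega))
  · calc commonDen r ^ (n + 1) ≤ (2 ^ b ^ 2) ^ (b + 1) := by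
          gcongr
          exact Nat.one_le_two_pow
      _ = 2 ^ (b ^ 3 + b ^ 2) := by rw [← pow_mul, mul_add_one, ← pow_succ]
      _ < 2 ^ (b ^ 3 + b ^ 2 + (3 * b ^ 2 + 2 * b + 1)) :=
          Nat.pow_lt_pow_right one_lt_two (by omega)
  · calc (r u).num * commonDen r ≤ 2 ^ b * 2 ^ b ^ 2 := Nat.mul_le_mul (hnum u).le hcommonDen
      _ = 2 ^ (b + b ^ 2) := (pow_add ..).symm
      _ < 2 ^ (b ^ 3 + b ^ 2 + (3 * b ^ 2 + 2 * b + 1)) :=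
          Nat.pow_lt_pow_right one_lt_two (by omega)

theorem exists_eliminates_outputsWithin_decisionProg (hG : IsChordal G) :
    ∃ L S, Eliminates G r L S ∧ S.remaining = ∅ ∧
      OutputsWithin decisionProg (encodeInput G r)
        (decisionTime.eval (bitSize (encodeInput G r))) (result L) ∧
      bitSize (result L) ≤ (loopBound * (wordLength + 1)).eval (bitSize (encodeInput G r)) := by
  have hfits := fits_encodeInput G r
  obtain ⟨s, ⟨L, S, he, hS, houtput⟩, hs, hrun⟩ :=
    (wp_decisionProg hG hfits (isInput_encodeInput G r) fun _ => initMem_of_ne _).outputsWithin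
      hfits.lt_two_pow (by simp [wordLength, loopBound]; omega)
  have hlength := he.length_result_le.trans hfits.length_le
  refine ⟨L, S, he, hS, by simpa [decisionTime, houtput] using hrun, ?_⟩
  calc bitSize (result L) ≤ (result L).length * (wordLength.eval (bitSize (encodeInput G r)) + 1) :=
        houtput ▸ hs.bitSize_output_le
    _ ≤ _ := by
      rw [Polynomial.eval_mul, Polynomial.eval_add, Polynomial.eval_one]
      gcongr

end Input

section Query

variable {n : ℕ} {G : SimpleGraph (Fin n)} {L : List (Round (Fin n))} {h : Fin n → ℕ} {v : Fin n}

theorem isQuery_encodeQuery (c : View G h v) (a : Fin (h v)) :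
    IsQuery L v a (seen c) (initMem (encodeQuery (description L) v c a) INPUT) := by
  classical
  have hread (k : ℕ) : initMem (encodeQuery (description L) v c a) INPUT (4 + k) =
      (List.ofFn (seen c) ++ description L)[k]?.getD 0 := by
    rw [add_comm 4, initMem_input]
    rfl
  have hread' {k : ℕ} (hk : k < L.length) {j : ℕ} (hj : j < 3 * n) :
      initMem (encodeQuery (description L) v c a) INPUT (4 + n + (3 * n * k + j)) =
        (List.ofFn L[k].radix ++ (List.ofFn L[k].lo ++ List.ofFn L[k].hi))[j]?.getD 0 := by
    rw [add_assoc, hread, List.getElem?_append_right (by simp), List.length_ofFn,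
      Nat.add_sub_cancel_left, description,
      getElem?_flatMap_of_length_eq (fun ρ => by simp; omega) hj hk, List.append_assoc]
  refine ⟨initMem_input _ 0, initMem_input _ 1, initMem_input _ 2, fun u => ?_, fun hk u => ?_,
    fun hk u => ?_, fun hk u => ?_⟩
  · rw [hread, List.getElem?_append_left (by simp)]
    simp
  · rw [hread' hk (by omega), List.getElem?_append_left (by simp)]
    simp
  · rw [hread' hk (by omega), List.getElem?_append_right (by simp), List.length_ofFn,
      Nat.add_sub_cancel_left, List.getElem?_append_left (by simp)]
    simp
  · rw [hread' hk (by omega), List.getElem?_append_right (by simp; omega), List.length_ofFn,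
      List.getElem?_append_right (by simp; omega), List.length_ofFn, two_mul, add_assoc,
      Nat.add_sub_cancel_left, Nat.add_sub_cancel_left]
    simp

theorem represents_strategy (hL : IsLegal G L) (hlength : L.length = n) :
    Represents evaluationProg evaluationTime (description L) (strategy hL) := by
  classical
  intro v c a
  have hquery := isQuery_encodeQuery (L := L) c a
  set x := encodeQuery (description L) v c a with hx
  have hn : n ≤ bitSize x := by
    refine le_trans ?_ (length_le_bitSize x)
    simp only [hx, encodeQuery, List.length_append, List.length_cons, List.length_ofFn]
    omega
  have hbounded := initMem_bounded (le_refl (bitSize x))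
  have hcolor (u : Fin n) : Function.update (seen c) v a u ≤ 2 ^ bitSize x := by
    rw [Function.update_apply]
    split_ifs
    exacts [hquery.color ▸ (hbounded INPUT 3).le, hquery.seen u ▸ (hbounded INPUT (4 + u)).le]
  have hsum : ∑ u, Function.update (seen c) v a u < 2 ^ (2 * bitSize x + 1) := by
    calc ∑ u, Function.update (seen c) v a u ≤ ∑ _u : Fin n, 2 ^ bitSize x :=
          Finset.sum_le_sum fun u _ => hcolor u
      _ = n * 2 ^ bitSize x := by simp
      _ ≤ 2 ^ bitSize x * 2 ^ bitSize x :=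
          Nat.mul_le_mul_right _ (hn.trans Nat.lt_two_pow_self.le)
      _ = 2 ^ (2 * bitSize x) := by rw [two_mul, pow_add]
      _ < 2 ^ (2 * bitSize x + 1) := Nat.pow_lt_pow_right one_lt_two (Nat.lt_succ_self _)
  obtain ⟨s, hs, -, hrun⟩ := (hquery.wp_evaluationProg hn hlength hsum fun _ =>
    initMem_of_ne _).outputsWithin
      (Nat.lt_two_pow_self.trans (Nat.pow_lt_pow_right one_lt_two (by omega))) (by omega)
  simpa [evaluationTime, strategy, hs, add_assoc] using hrun

end Query

end HatGame

open HatGame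

/-- One program `alg` decides `r ∈ 𝓡(G)` (first entry of the output) and, if `r ∉ 𝓡(G)`, also
outputs `h`, `g` and a description `σ` of a winning strategy for `(G, h, g)`; it runs in time
`p`, its output has length at most `p'`, and descriptions are evaluated by one program `ev` in
time `q`. -/
theorem corollary3 :
    ∃ (alg ev : HatGame.Prog) (p p' q : Polynomial ℕ),
      ∀ (n : ℕ) (G : SimpleGraph (Fin n)) (r : Fin n → ℚ≥0), HatGame.IsChordal G →
        ((fun v => (r v : ℝ)) ∈ HatGame.region G →
          HatGame.OutputsWithin alg (HatGame.encodeInput G r)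
            (p.eval (HatGame.bitSize (HatGame.encodeInput G r))) [1]) ∧
        ((fun v => (r v : ℝ)) ∉ HatGame.region G →
          ∃ (h g : Fin n → ℕ) (σ : List ℕ),
            HatGame.OutputsWithin alg (HatGame.encodeInput G r)
              (p.eval (HatGame.bitSize (HatGame.encodeInput G r)))
              (0 :: (List.ofFn h ++ List.ofFn g ++ σ)) ∧
            HatGame.bitSize (List.ofFn h ++ List.ofFn g ++ σ) ≤
              p'.eval (HatGame.bitSize (HatGame.encodeInput G r)) ∧
            (∀ v, 0 < h v ∧ (g v : ℚ≥0) / (h v : ℚ≥0) ≤ r v) ∧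
            ∃ Γ : HatGame.Strategy G h g, Γ.IsWinning ∧ HatGame.Represents ev q σ Γ) := by
  refine ⟨decisionProg, evaluationProg, decisionTime, loopBound * (wordLength + 1), evaluationTime,
    fun n G r hG => ?_⟩
  obtain ⟨L, S, hL, hS, hrun, hsize⟩ := exists_eliminates_outputsWithin_decisionProg G r hG
  have hiff := hL.exists_modulus_le_guess_iff hS
  rw [result] at hrun hsize
  refine ⟨fun hr => ?_, fun hr => ?_⟩
  · rwa [if_neg (hiff.not.2 (not_not.2 hr))] at hrun
  · have hsure := hiff.2 hr
    have hlength : L.length = n := by simpa [hS] using hL.length_add_card_remaining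
    rw [if_pos hsure] at hrun hsize
    exact ⟨colors L, guesses L, description L, hrun, (Nat.le_add_left _ _).trans hsize,
      fun v => ⟨hL.isLegal.colors_pos v, hL.guesses_div_colors_le hS v⟩,
      strategy hL.isLegal, isWinning_strategy hL.isLegal hsure,
      represents_strategy hL.isLegal hlength⟩
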